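/- Let $G$ be a simply connected (real, smooth) Lie group of dimension $n\ge 3$ whose Lie algebra is almost abelian, i.e. has an abelian ideal of codimension $1$, and let $c$ be a conformal class of Riemannian metrics on $G$ that contains a left-invariant metric. A Weyl structure on $(G,c)$ is a torsion-free linear connection $\nabla$ on $G$ that preserves $c$, i.e. for every $g\in c$ there is a $1$-form $\theta_g$ (the Lee form of $\nabla$ with respect to $g$) with $\nabla g=-2\theta_g\otimes g$. It is called left-invariant if $\theta_g$ is left-invariant for every left-invariant metric $g\in c$. With $R^\nabla(X,Y)Z=\nabla_{[X,Y]}Z-\nabla_X\nabla_YZ+\nabla_Y\nabla_XZ$ and $\mathrm{Ric}^\nabla(X,Y)=\mathrm{Tr}\bigl(Z\mapsto R^\nabla(X,Z)Y\bigr)$, it is called Weyl-Einstein if the trace-free symmetric part of $\mathrm{Ric}^\nabla$ vanishes, i.e. for some (equivalently every) $g\in c$, with $\mathrm{scal}^\nabla_g=\mathrm{Tr}_g\mathrm{Ric}^\nabla$, $$\tfrac12\bigl(\mathrm{Ric}^\nabla(X,Y)+\mathrm{Ric}^\nabla(Y,X)\bigr)=\tfrac1n\,\mathrm{scal}^\nabla_g\,g(X,Y)\quad\text{for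 all vector fields }X,Y.$$ Then every left-invariant Weyl-Einstein structure $\nabla$ on $(G,c)$ is the Levi-Civita connection of an Einstein metric in $c$: there is a Riemannian metric $h\in c$ such that $\nabla=\nabla^h$ and $\mathrm{Ric}^{\nabla^h}=\frac1n\,\mathrm{scal}_h\,h$. -/

import Mathlib

open Bundle Manifold
open scoped ContDiff

noncomputable section

/-- A Lie algebra is almost abelian if it has an abelian ideal of codimension one. -/
def IsAlmostAbelian (R L : Type*) [CommRing R] [LieRing L] [LieAlgebra R L] : Prop :=
  ∃ 𝔥 : LieIdeal R L, IsLieAbelian 𝔥 ∧ Module.finrank R (L ⧸ 𝔥.toSubmodule) = 1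

/-- A smooth real Lie group is smooth enough to carry its Lie algebra structure. -/
instance instLEInftyMinSmoothnessRealThree : ENat.LEInfty (minSmoothness ℝ 3) :=
  ⟨by rw [minSmoothness_of_isRCLikeNormedField]; exact ENat.LEInfty.out⟩

namespace WeylGeometry

section Manifold

variable {E : Type*} [NormedAddCommGroup E] [NormedSpace ℝ E] [FiniteDimensional ℝ E]
  {H : Type*} [TopologicalSpace H] (I : ModelWithCorners ℝ E H)
  (M : Type*) [TopologicalSpace M] [ChartedSpace H M] [IsManifold I ∞ M]

/-- Smooth Riemannian metrics on `M`. -/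
abbrev SmoothMetric : Type _ :=
  ContMDiffRiemannianMetric I ∞ E (fun x : M ↦ TangentSpace I x)

/-- Linear connections on `M`; `D Y x (X x)` is the value of `∇_X Y` at `x`. -/
abbrev LinearConnection : Type _ :=
  CovariantDerivative I E (fun x : M ↦ TangentSpace I x)

variable {I M}

/-- The metrics `g` and `g'` are conformal: `g' = e^{2f} g` for a smooth function `f`. -/
def Conformal (g g' : SmoothMetric I M) : Prop :=
  ∃ f : M → ℝ, ContMDiff I 𝓘(ℝ, ℝ) ∞ f ∧
    ∀ (x : M) (u v : TangentSpace I x),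
      g'.inner x u v = Real.exp (2 * f x) * g.inner x u v

variable (I M) in
/-- Conformality is an equivalence relation on the smooth metrics on `M`. -/
def conformalSetoid : Setoid (SmoothMetric I M) where
  r := Conformal
  iseqv :=
    { refl := fun g ↦ ⟨fun _ ↦ 0, contMDiff_const, fun x u v ↦ by simp⟩
      symm := by
        rintro g g' ⟨f, hf, h⟩
        refine ⟨fun x ↦ -f x, hf.neg, fun x u v ↦ ?_⟩
        rw [h, ← mul_assoc, ← Real.exp_add]
        simp
      trans := by
        rintro g g' g'' ⟨f, hf, h⟩ ⟨f', hf', h'⟩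
        refine ⟨fun x ↦ f x + f' x, hf.add hf', fun x u v ↦ ?_⟩
        rw [h', h, ← mul_assoc, ← Real.exp_add]
        ring_nf }

variable (I M) in
/-- Conformal classes on `M`. -/
def ConformalClass : Type _ := Quotient (conformalSetoid I M)

/-- `g ∈ c`: the metric `g` belongs to the conformal class `c`. -/
instance : Membership (SmoothMetric I M) (ConformalClass I M) where
  mem c g := Quotient.mk (conformalSetoid I M) g = c

/-- `θ` is a smooth 1-form on `M`. -/
def IsSmoothOneForm (θ : ∀ x : M, TangentSpace I x →L[ℝ] ℝ) : Prop :=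
  ContMDiff I (I.prod 𝓘(ℝ, E →L[ℝ] ℝ)) ∞ (fun x ↦ TotalSpace.mk' (E →L[ℝ] ℝ) x (θ x))

/-- `(∇_X g)(Y, Z) = X(g(Y, Z)) - g(∇_X Y, Z) - g(Y, ∇_X Z)` at the point `x`, where `u = X x`. -/
def metricDerivative (D : LinearConnection I M) (g : SmoothMetric I M)
    (Y Z : ∀ x : M, TangentSpace I x) (x : M) (u : TangentSpace I x) : ℝ :=
  mvfderiv I (fun y : M ↦ g.inner y (Y y) (Z y)) x u
    - g.inner x (D Y x u) (Z x) - g.inner x (Y x) (D Z x u)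

/-- `θ` is the Lee form of the connection `D` with respect to `g`: `∇g = -2 θ ⊗ g`. -/
def IsLeeForm (D : LinearConnection I M) (g : SmoothMetric I M)
    (θ : ∀ x : M, TangentSpace I x →L[ℝ] ℝ) : Prop :=
  IsSmoothOneForm θ ∧
    ∀ (Y Z : ∀ x : M, TangentSpace I x) (x : M),
      MDiffAt (T% Y) x → MDiffAt (T% Z) x → ∀ u : TangentSpace I x,
        metricDerivative D g Y Z x u = -2 * θ x u * g.inner x (Y x) (Z x)

/-- `D` is the Levi-Civita connection of `g`: it is torsion-free and `∇g = 0`. -/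
def IsLeviCivita (D : LinearConnection I M) (g : SmoothMetric I M) : Prop :=
  D.torsion = 0 ∧
    ∀ (Y Z : ∀ x : M, TangentSpace I x) (x : M),
      MDiffAt (T% Y) x → MDiffAt (T% Z) x → ∀ u : TangentSpace I x,
        metricDerivative D g Y Z x u = 0

/-- A Weyl structure on the conformal manifold `(M, c)`: a smooth torsion-free linear connection
which preserves `c`, that is, `∇g = -2 θ ⊗ g` with a 1-form `θ`, for every `g ∈ c`. -/
structure WeylStructure (c : ConformalClass I M) where
  conn : LinearConnection I M
  smooth : CovariantDerivative.ContMDiffCovariantDerivative conn ∞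
  torsion_eq_zero : conn.torsion = 0
  preserves : ∀ g ∈ c, ∃ θ : ∀ x : M, TangentSpace I x →L[ℝ] ℝ, IsLeeForm conn g θ

/-- `R(X, Y) Z = ∇_{[X, Y]} Z - ∇_X ∇_Y Z + ∇_Y ∇_X Z`. -/
def curvature (D : LinearConnection I M) (X Y Z : ∀ x : M, TangentSpace I x) (x : M) :
    TangentSpace I x :=
  D Z x (VectorField.mlieBracket I X Y x)
    - D (fun y ↦ D Z y (Y y)) x (X x) + D (fun y ↦ D Z y (X y)) x (Y x)

/-- A basis of the tangent space at `x`. -/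
def tangentBasis (x : M) :
    Module.Basis (Fin (Module.finrank ℝ E)) ℝ (TangentSpace I x) :=
  Module.finBasis ℝ E

/-- The Ricci tensor `Ric(u, w) = Tr (v ↦ R(u, v) w)` at `x`. The curvature is evaluated on
extensions of the tangent vectors to vector fields that are smooth near `x`; for a smooth
connection it does not depend on the extensions, nor the trace on the basis. -/
def ricci (D : LinearConnection I M) (x : M) (u w : TangentSpace I x) : ℝ :=
  ∑ i, (tangentBasis (I := I) x).coord i
    (curvature D (FiberBundle.extend E u) (FiberBundle.extend E (tangentBasis (I := I) x i))
      (FiberBundle.extend E w) x)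

/-- The scalar curvature of `D` with respect to `g`: the `g`-trace `∑ g^{ij} Ric_{ij}` of the Ricci
tensor of `D`. -/
def scalarCurvature (D : LinearConnection I M) (g : SmoothMetric I M) (x : M) : ℝ :=
  ∑ i, ∑ j,
    (Matrix.of fun k l ↦
      g.inner x (tangentBasis (I := I) x k) (tangentBasis (I := I) x l))⁻¹ i j *
      ricci D x (tangentBasis (I := I) x i) (tangentBasis (I := I) x j)

/-- A Weyl structure is Weyl-Einstein if the trace-free part of the symmetric part of its Ricci
tensor vanishes; `n` is the dimension of `M`. -/
def WeylStructure.IsWeylEinstein {c : ConformalClass I M} (D : WeylStructure c) : Prop :=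
  ∃ g ∈ c, ∀ (x : M) (u v : TangentSpace I x),
    (ricci D.conn x u v + ricci D.conn x v u) / 2 =
      1 / (Module.finrank ℝ E : ℝ) * scalarCurvature D.conn g x * g.inner x u v

/-- `g` is Einstein: `Ric = (1/n) scal g` for the Levi-Civita connection of `g`. -/
def IsEinstein (g : SmoothMetric I M) : Prop :=
  ∃ D : LinearConnection I M, IsLeviCivita D g ∧
    CovariantDerivative.ContMDiffCovariantDerivative D ∞ ∧
    ∀ (x : M) (u v : TangentSpace I x),
      ricci D x u v =
        1 / (Module.finrank ℝ E : ℝ) * scalarCurvature D g x * g.inner x u v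

end Manifold

section Group

variable {E : Type*} [NormedAddCommGroup E] [NormedSpace ℝ E] [FiniteDimensional ℝ E]
  {H : Type*} [TopologicalSpace H] {I : ModelWithCorners ℝ E H}
  {G : Type*} [TopologicalSpace G] [ChartedSpace H G] [Group G] [LieGroup I ∞ G]

/-- The metric `g` is invariant under all left translations. -/
def IsLeftInvariantMetric (g : SmoothMetric I G) : Prop :=
  ∀ (a x : G) (u v : TangentSpace I x),
    g.inner (a * x) (mfderiv I I (fun y ↦ a * y) x u) (mfderiv I I (fun y ↦ a * y) x v) =
      g.inner x u v

/-- The 1-form `θ` is invariant under all left translations. -/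
def IsLeftInvariantOneForm (θ : ∀ x : G, TangentSpace I x →L[ℝ] ℝ) : Prop :=
  ∀ (a x : G) (u : TangentSpace I x), θ (a * x) (mfderiv I I (fun y ↦ a * y) x u) = θ x u

/-- `(G, c)` is a conformal Lie group: `c` contains a left-invariant metric. -/
def IsConformalLieGroup (c : ConformalClass I G) : Prop :=
  ∃ g ∈ c, IsLeftInvariantMetric g

/-- A Weyl structure is left-invariant if its Lee form with respect to any left-invariant metric
in the conformal class is left-invariant. -/
def WeylStructure.IsLeftInvariant {c : ConformalClass I G} (D : WeylStructure c) : Prop :=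
  ∀ g ∈ c, IsLeftInvariantMetric g →
    ∀ θ : ∀ x : G, TangentSpace I x →L[ℝ] ℝ, IsLeeForm D.conn g θ → IsLeftInvariantOneForm θ

end Group

end WeylGeometry

end

noncomputable section

namespace WeylGeometry

section FrameAlgebra

/-- The coefficients `⟨∇_{e_i} e_j, e_k⟩` of the Weyl connection with constant Lee form `θ` in an
orthonormal frame with constant structure coefficients `c`. -/
def weylChristoffel {ι : Type*} [DecidableEq ι] (c : ι → ι → ι → ℝ) (θ : ι → ℝ) (i j k : ι) : ℝ :=
  (c i j k - c j k i + c k i j) / 2 + (if j = k then θ i else 0) + (if i = k then θ j else 0)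
    - (if i = j then θ k else 0)

/-- The Ricci tensor, in a frame with constant structure coefficients `c`, of a connection with
constant coefficients `Γ`. -/
def frameRicci {ι : Type*} [Fintype ι] (c Γ : ι → ι → ι → ℝ) (a b : ι) : ℝ :=
  ∑ z, ∑ k, (c a z k * Γ k b z - Γ z b k * Γ a k z + Γ a b k * Γ z k z)

/-- In the frame `e_0, …, e_m`, the fields `e_1, …, e_m` span an abelian ideal, on which `e_0` acts
by a matrix with symmetric part `S` and skew-symmetric part `K`. -/
structure IsAlmostAbelianFrame {m : ℕ} (c : Fin (m + 1) → Fin (m + 1) → Fin (m + 1) → ℝ)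
    (S K : Fin m → Fin m → ℝ) : Prop where
  antisymm : ∀ i j k, c i j k = -c j i k
  ideal : ∀ i j, c i j 0 = 0
  abelian : ∀ (i j : Fin m) k, c i.succ j.succ k = 0
  action : ∀ i j : Fin m, c 0 i.succ j.succ = S i j + K i j
  symm : ∀ i j, S i j = S j i
  skew : ∀ i j, K i j = -K j i

namespace IsAlmostAbelianFrame

variable {m : ℕ} {c : Fin (m + 1) → Fin (m + 1) → Fin (m + 1) → ℝ} {S K : Fin m → Fin m → ℝ}
  (hc : IsAlmostAbelianFrame c S K) (θ : Fin (m + 1) → ℝ)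
include hc

lemma coeff_self (i k) : c i i k = 0 := by
  have := hc.antisymm i i k
  linarith

lemma skew_self (i) : K i i = 0 := by
  have := hc.skew i i
  linarith

lemma action' (i j : Fin m) : c i.succ 0 j.succ = -S i j - K i j := by
  rw [hc.antisymm, hc.action]
  ring

lemma christoffel_000 : weylChristoffel c θ 0 0 0 = θ 0 := by
  simp [weylChristoffel, hc.ideal]

lemma christoffel_00s (k : Fin m) : weylChristoffel c θ 0 0 k.succ = -θ k.succ := by
  simp [weylChristoffel, hc.ideal, hc.coeff_self, (Fin.succ_ne_zero _).symm]

lemma christoffel_0s0 (j : Fin m) : weylChristoffel c θ 0 j.succ 0 = θ j.succ := by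
  simp [weylChristoffel, hc.ideal, hc.coeff_self, (Fin.succ_ne_zero _).symm]

lemma christoffel_0ss (j k : Fin m) : weylChristoffel c θ 0 j.succ k.succ =
    K j k + if j = k then θ 0 else 0 := by
  simp [weylChristoffel, hc.abelian, (Fin.succ_ne_zero _).symm, hc.action, hc.action']
  rw [hc.symm k j, hc.skew k j]
  ring

lemma christoffel_s00 (i : Fin m) : weylChristoffel c θ i.succ 0 0 = θ i.succ := by
  simp [weylChristoffel, hc.ideal, hc.coeff_self]

lemma christoffel_s0s (i k : Fin m) : weylChristoffel c θ i.succ 0 k.succ =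
    -S i k + if i = k then θ 0 else 0 := by
  simp [weylChristoffel, hc.abelian, (Fin.succ_ne_zero _).symm, hc.action, hc.action']
  rw [hc.symm k i, hc.skew k i]
  ring

lemma christoffel_ss0 (i j : Fin m) : weylChristoffel c θ i.succ j.succ 0 =
    S i j - if i = j then θ 0 else 0 := by
  simp [weylChristoffel, hc.abelian, hc.action, hc.action']
  rw [hc.symm j i, hc.skew j i]
  ring

lemma christoffel_sss (i j k : Fin m) : weylChristoffel c θ i.succ j.succ k.succ =
    (if j = k then θ i.succ else 0) + (if i = k then θ j.succ else 0)
      - if i = j then θ k.succ else 0 := by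
  simp [weylChristoffel, hc.abelian]

lemma sum_symm_mul_skew : ∑ i, ∑ j, S i j * K i j = 0 := by
  have h : ∑ i, ∑ j, S i j * K i j = ∑ i, ∑ j, -(S i j * K i j) := by
    rw [Finset.sum_comm]
    refine Finset.sum_congr rfl fun i _ ↦ Finset.sum_congr rfl fun j _ ↦ ?_
    rw [hc.symm, hc.skew]
    ring
  simp only [Finset.sum_neg_distrib] at h
  linarith

lemma ricci_00 : frameRicci c (weylChristoffel c θ) 0 0 =
    -∑ i, ∑ j, S i j ^ 2 + θ 0 * ∑ i, S i i + (1 - m) * ∑ i : Fin m, θ i.succ ^ 2 := by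
  have hSS : ∑ i, ∑ j, S i j * S j i = ∑ i, ∑ j, S i j ^ 2 :=
    Finset.sum_congr rfl fun i _ ↦ Finset.sum_congr rfl fun j _ ↦ by rw [hc.symm j i, pow_two]
  have hKS : ∑ i, ∑ j, K i j * S j i = 0 := by
    rw [← hc.sum_symm_mul_skew]
    exact Finset.sum_congr rfl fun i _ ↦ Finset.sum_congr rfl fun j _ ↦ by
      rw [hc.symm j i, mul_comm]
  have hSK : ∑ i, ∑ j, S i j * K j i = 0 := by
    rw [← hKS, Finset.sum_comm]
    exact Finset.sum_congr rfl fun i _ ↦ Finset.sum_congr rfl fun j _ ↦ mul_comm _ _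
  simp only [frameRicci, Fin.sum_univ_succ, hc.christoffel_000, hc.christoffel_00s,
    hc.christoffel_0s0, hc.christoffel_0ss, hc.christoffel_s00, hc.christoffel_s0s,
    hc.christoffel_sss, hc.ideal, hc.coeff_self, hc.action]
  simp [mul_add, add_mul, mul_sub, sub_mul, Finset.sum_add_distrib, Finset.sum_sub_distrib,
    hc.skew_self, ← Finset.mul_sum, ← Finset.sum_mul, ← pow_two, hSS, hKS, hSK]
  ring

lemma ricci_0s_add_s0 (j : Fin m) :
    frameRicci c (weylChristoffel c θ) 0 j.succ + frameRicci c (weylChristoffel c θ) j.succ 0 =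
      (m - 1) * (∑ x, K j x * θ x.succ - ∑ x, S j x * θ x.succ + 2 * θ 0 * θ j.succ) := by
  have hS : ∑ x, S x j * θ x.succ = ∑ x, S j x * θ x.succ :=
    Finset.sum_congr rfl fun x _ ↦ by rw [hc.symm]
  have hS' : ∑ x : Fin m, θ x.succ * S j x = ∑ x, S j x * θ x.succ :=
    Finset.sum_congr rfl fun x _ ↦ mul_comm _ _
  have hK : ∑ x, K x j * θ x.succ = -∑ x, K j x * θ x.succ := by
    rw [← Finset.sum_neg_distrib]
    exact Finset.sum_congr rfl fun x _ ↦ by rw [hc.skew]; ring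
  have hK' : ∑ x : Fin m, θ x.succ * K j x = ∑ x, K j x * θ x.succ :=
    Finset.sum_congr rfl fun x _ ↦ mul_comm _ _
  have hK'' : ∑ x : Fin m, θ x.succ * K x j = -∑ x, K j x * θ x.succ := by
    rw [← hK]
    exact Finset.sum_congr rfl fun x _ ↦ mul_comm _ _
  simp only [frameRicci, Fin.sum_univ_succ, hc.christoffel_000, hc.christoffel_00s,
    hc.christoffel_0s0, hc.christoffel_0ss, hc.christoffel_s00, hc.christoffel_s0s,
    hc.christoffel_ss0, hc.christoffel_sss, hc.ideal, hc.coeff_self, hc.action, hc.action',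
    hc.abelian]
  simp [mul_add, add_mul, mul_sub, sub_mul, Finset.sum_add_distrib, Finset.sum_sub_distrib,
    hc.skew_self, ← Finset.mul_sum, ← Finset.sum_mul, hS, hS', hK, hK', hK'']
  ring

lemma ricci_0s (h : ∀ i : Fin m, θ i.succ = 0) (j : Fin m) :
    frameRicci c (weylChristoffel c θ) 0 j.succ = 0 := by
  simp only [frameRicci, Fin.sum_univ_succ, hc.christoffel_000, hc.christoffel_00s,
    hc.christoffel_0s0, hc.christoffel_0ss, hc.christoffel_s0s,
    hc.christoffel_ss0, hc.christoffel_sss, hc.ideal, hc.coeff_self, h]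
  simp

lemma ricci_ss (i j : Fin m) : frameRicci c (weylChristoffel c θ) i.succ j.succ =
    -(∑ x, K i x * S x j) - ∑ x, K j x * S x i + ((m - 1) * θ 0 - ∑ x, S x x) * S i j
      + (m - 1) * (θ i.succ * θ j.succ) + if i = j then
        θ 0 * ∑ x, S x x + (1 - m) * (θ 0 ^ 2 + ∑ x : Fin m, θ x.succ ^ 2) else 0 := by
  have hSS : ∑ x, S x j * S i x = ∑ x, S i x * S x j :=
    Finset.sum_congr rfl fun x _ ↦ mul_comm _ _
  have hKS : ∑ x, K j x * S i x = ∑ x, K j x * S x i :=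
    Finset.sum_congr rfl fun x _ ↦ by rw [hc.symm i x]
  simp only [frameRicci, Fin.sum_univ_succ, hc.christoffel_000, 
    hc.christoffel_0s0, hc.christoffel_0ss, hc.christoffel_s00, hc.christoffel_s0s,
    hc.christoffel_ss0, hc.christoffel_sss, hc.ideal, hc.action', hc.abelian]
  simp [mul_add, add_mul, mul_sub, sub_mul, Finset.sum_add_distrib, Finset.sum_sub_distrib,
    ← Finset.mul_sum, ← pow_two, hSS, hKS]
  by_cases h : i = j
  · subst h
    simp [hc.skew_self]
    ring
  · simp [h, Ne.symm h, hc.skew j i]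
    ring

lemma ricci_symm (h : ∀ i : Fin m, θ i.succ = 0) (a b : Fin (m + 1)) :
    frameRicci c (weylChristoffel c θ) a b = frameRicci c (weylChristoffel c θ) b a := by
  have h0 (j : Fin m) : frameRicci c (weylChristoffel c θ) j.succ 0 = 0 := by
    have := hc.ricci_0s_add_s0 θ j
    simpa [hc.ricci_0s θ h, h] using this
  refine Fin.cases (Fin.cases rfl (fun j ↦ ?_) b) (fun i ↦ Fin.cases ?_ (fun j ↦ ?_) b) a
  · rw [hc.ricci_0s θ h, h0]
  · rw [hc.ricci_0s θ h, h0]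
  · rw [hc.ricci_ss, hc.ricci_ss, hc.symm j i]
    simp only [h, eq_comm (a := i) (b := j)]
    ring

lemma sum_mul_skew_mul : ∑ i, ∑ j, S i j * ∑ x, K i x * S x j = 0 := by
  have h : ∑ i, ∑ j, S i j * ∑ x, K i x * S x j = -∑ i, ∑ j, S i j * ∑ x, K i x * S x j := by
    calc ∑ i, ∑ j, S i j * ∑ x, K i x * S x j
        = ∑ i, ∑ x, ∑ j, S i j * (K i x * S x j) := by
          simp_rw [Finset.mul_sum]
          exact Finset.sum_congr rfl fun i _ ↦ Finset.sum_comm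
      _ = ∑ x, ∑ i, ∑ j, S i j * (K i x * S x j) := Finset.sum_comm
      _ = ∑ x, ∑ j, ∑ i, S i j * (K i x * S x j) :=
          Finset.sum_congr rfl fun i _ ↦ Finset.sum_comm
      _ = -∑ i, ∑ j, S i j * ∑ x, K i x * S x j := by
          simp_rw [Finset.mul_sum, ← Finset.sum_neg_distrib]
          refine Finset.sum_congr rfl fun x _ ↦ Finset.sum_congr rfl fun j _ ↦
            Finset.sum_congr rfl fun i _ ↦ ?_
          rw [hc.skew i x]
          ring
  linarith

end IsAlmostAbelianFrame

/-- The squared norm of `S - α - β η ⊗ η` is nonnegative. -/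
lemma sum_sq_sub_nonneg {m : ℕ} (S : Fin m → Fin m → ℝ) (η : Fin m → ℝ) (α β : ℝ) :
    0 ≤ ∑ i, ∑ j, S i j ^ 2 - 2 * α * ∑ i, S i i - 2 * β * ∑ i, ∑ j, S i j * η i * η j
      + m * α ^ 2 + β ^ 2 * (∑ i, η i ^ 2) ^ 2 + 2 * α * β * ∑ i, η i ^ 2 := by
  have h : 0 ≤ ∑ i, ∑ j, (S i j - (if i = j then α else 0) - β * (η i * η j)) ^ 2 :=
    Finset.sum_nonneg fun i _ ↦ Finset.sum_nonneg fun j _ ↦ sq_nonneg _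
  have e (i j : Fin m) : (S i j - (if i = j then α else 0) - β * (η i * η j)) ^ 2 =
      S i j ^ 2 - (if i = j then 2 * α * S i j else 0) - 2 * β * (S i j * η i * η j)
        + (if i = j then α ^ 2 else 0) + β ^ 2 * (η i ^ 2 * η j ^ 2)
        + if i = j then 2 * α * β * (η i * η j) else 0 := by
    split_ifs <;> ring
  simp only [e, Finset.sum_add_distrib, Finset.sum_sub_distrib, Finset.sum_ite_eq,
    Finset.mem_univ, if_true, ← Finset.mul_sum, ← Finset.sum_mul] at h
  simp only [Finset.sum_const, Finset.card_univ, Fintype.card_fin, nsmul_eq_mul, ← pow_two] at h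
  convert! h using 1

/-- The contracted Weyl-Einstein equations force the Lee form to vanish on the abelian ideal. -/
lemma lee_norm_eq_zero {m s q t N μ : ℝ} (hm : 2 ≤ m) (hN : 0 ≤ N)
    (hpos : ∀ α β : ℝ, 0 ≤ q - 2 * α * s - 2 * β * (2 * t * N) + m * α ^ 2 + β ^ 2 * N ^ 2
      + 2 * α * β * N)
    (h0 : μ = -q + t * s + (1 - m) * N)
    (htr : ((m - 1) * t - s) * s + (m - 1) * N + m * (t * s + (1 - m) * (t ^ 2 + N)) = m * μ)
    (hS : ((m - 1) * t - s) * q + (m - 1) * (2 * t * N) + s * (t * s + (1 - m) * (t ^ 2 + N))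
      = s * μ) : N = 0 := by
  have h1 : -s ^ 2 + (m - 1) * t * s + (m - 1) * N + m * (1 - m) * t ^ 2 = -m * q := by
    rw [h0] at htr
    linear_combination htr
  have h2 : (m - 1) * (t * (q + 2 * N - t * s)) = 0 := by
    rw [h0] at hS
    linear_combination hS
  have hm1 : m - 1 ≠ 0 := by linarith
  rcases mul_eq_zero.1 ((mul_eq_zero.1 h2).resolve_left hm1) with ht | ht
  · have h3 := hpos (s / m) 0
    have h4 : 0 ≤ m * (q - 2 * (s / m) * s + m * (s / m) ^ 2) := by
      refine mul_nonneg (by linarith) ?_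
      simpa using h3
    have h5 : m * (q - 2 * (s / m) * s + m * (s / m) ^ 2) = m * q - s ^ 2 := by
      have : m ≠ 0 := by linarith
      field_simp
      ring
    rw [ht] at h1
    nlinarith
  · by_contra hne
    have hN' : 0 < N := lt_of_le_of_ne hN (Ne.symm hne)
    set α := (s - 2 * t) / (m - 1) with hα
    have h3 := hpos α ((2 * t - α) / N)
    have h4 : q - 2 * α * s - 2 * ((2 * t - α) / N) * (2 * t * N) + m * α ^ 2
        + ((2 * t - α) / N) ^ 2 * N ^ 2 + 2 * α * ((2 * t - α) / N) * N =
        q - 4 * t ^ 2 - (s - 2 * t) ^ 2 / (m - 1) := by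
      rw [hα]
      field_simp
      ring
    rw [h4] at h3
    have h5 : (s - 2 * t) ^ 2 / (m - 1) ≤ q - 4 * t ^ 2 := by linarith
    rw [div_le_iff₀ (by linarith)] at h5
    have h6 : (m * t - s) * (t - (m * t - s)) = (m + 1) * N := by
      linear_combination h1 - m * ht
    set δ := m * t - s with hδ
    have hs : s = m * t - δ := by rw [hδ]; ring
    have h7 : 0 < δ * (t - δ) := by
      rw [h6]
      exact mul_pos (by linarith) hN'
    have hq : q = t * s - 2 * N := by linarith
    rw [hq, hs] at h5
    have h8 : 0 ≤ (m - 1) * N := mul_nonneg (by linarith) hN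
    have h9 : 0 ≤ m * (t - δ) ^ 2 := mul_nonneg (by linarith) (sq_nonneg _)
    have h10 : 0 ≤ m * (δ * (t - δ)) := mul_nonneg (by linarith) h7.le
    nlinarith [sq_nonneg δ]

namespace IsAlmostAbelianFrame

variable {m : ℕ} {c : Fin (m + 1) → Fin (m + 1) → Fin (m + 1) → ℝ} {S K : Fin m → Fin m → ℝ}

theorem lee_eq_zero (hc : IsAlmostAbelianFrame c S K) (hm : 2 ≤ m) (θ : Fin (m + 1) → ℝ) (μ : ℝ)
    (hE : ∀ a b, (frameRicci c (weylChristoffel c θ) a b + frameRicci c (weylChristoffel c θ) b a)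
      / 2 = if a = b then μ else 0) (i : Fin m) : θ i.succ = 0 := by
  have hm' : (2 : ℝ) ≤ m := by exact_mod_cast hm
  have h00 := hE 0 0
  rw [hc.ricci_00] at h00
  have hSη : ∑ i, ∑ j, S i j * θ i.succ * θ j.succ = 2 * θ 0 * ∑ i : Fin m, θ i.succ ^ 2 := by
    have h (j : Fin m) : ∑ x, S j x * θ j.succ * θ x.succ =
        ∑ x, K j x * (θ j.succ * θ x.succ) + 2 * θ 0 * θ j.succ ^ 2 := by
      have := hE 0 j.succ
      rw [hc.ricci_0s_add_s0, if_neg (Fin.succ_ne_zero _).symm] at this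
      have h3 : ∑ x, K j x * θ x.succ - ∑ x, S j x * θ x.succ + 2 * θ 0 * θ j.succ = 0 := by
        have h1 : (m - 1 : ℝ) ≠ 0 := by linarith
        have h2 : ((m : ℝ) - 1) * (∑ x, K j x * θ x.succ - ∑ x, S j x * θ x.succ
          + 2 * θ 0 * θ j.succ) = 0 := by linarith
        exact (mul_eq_zero.1 h2).resolve_left h1
      have e1 : ∑ x, S j x * θ j.succ * θ x.succ = θ j.succ * ∑ x, S j x * θ x.succ := by
        rw [Finset.mul_sum]
        exact Finset.sum_congr rfl fun x _ ↦ by ring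
      have e2 : ∑ x, K j x * (θ j.succ * θ x.succ) = θ j.succ * ∑ x, K j x * θ x.succ := by
        rw [Finset.mul_sum]
        exact Finset.sum_congr rfl fun x _ ↦ by ring
      rw [e1, e2]
      linear_combination -θ j.succ * h3
    have hK : ∑ j, ∑ x, K j x * (θ j.succ * θ x.succ) = 0 := by
      have h : ∑ j, ∑ x, K j x * (θ j.succ * θ x.succ) =
          -∑ j, ∑ x, K j x * (θ j.succ * θ x.succ) := by
        nth_rw 1 [Finset.sum_comm]
        simp_rw [← Finset.sum_neg_distrib]
        refine Finset.sum_congr rfl fun i _ ↦ Finset.sum_congr rfl fun j _ ↦ ?_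
        rw [hc.skew j i]
        ring
      linarith
    simp_rw [h, Finset.sum_add_distrib, hK, ← Finset.mul_sum, zero_add]
  have hij (i j : Fin m) : (if i = j then μ else 0) =
      -(∑ x, K i x * S x j) - ∑ x, K j x * S x i + ((m - 1) * θ 0 - ∑ x, S x x) * S i j
        + (m - 1) * (θ i.succ * θ j.succ) + if i = j then
          θ 0 * ∑ x, S x x + (1 - m) * (θ 0 ^ 2 + ∑ x : Fin m, θ x.succ ^ 2) else 0 := by
    have := hE i.succ j.succ
    rw [hc.ricci_ss, hc.ricci_ss, hc.symm j i] at this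
    simp only [Fin.succ_inj, eq_comm (a := j) (b := i)] at this
    rw [← this]
    ring
  have htr : ∑ i : Fin m, (if i = i then μ else 0) = m * μ := by simp
  rw [Finset.sum_congr rfl fun i _ ↦ hij i i] at htr
  have hKS : ∑ i, ∑ x, K i x * S x i = 0 := by
    rw [← hc.sum_symm_mul_skew]
    exact Finset.sum_congr rfl fun i _ ↦ Finset.sum_congr rfl fun j _ ↦ by
      rw [hc.symm j i, mul_comm]
  have hS : ∑ i : Fin m, ∑ j : Fin m, S i j * (if i = j then μ else 0) = (∑ i, S i i) * μ := by
    simp [Finset.sum_mul]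
  rw [Finset.sum_congr rfl fun i _ ↦ Finset.sum_congr rfl fun j _ ↦ by rw [hij i j]] at hS
  have hSK := hc.sum_mul_skew_mul
  have hSK' : ∑ i, ∑ j, S i j * ∑ x, K j x * S x i = 0 := by
    rw [← hSK, Finset.sum_comm]
    exact Finset.sum_congr rfl fun i _ ↦ Finset.sum_congr rfl fun j _ ↦ by rw [hc.symm]
  have hpos := sum_sq_sub_nonneg S (fun i ↦ θ i.succ)
  have hη : ∑ i : Fin m, θ i.succ ^ 2 = 0 := by
    refine lee_norm_eq_zero (s := ∑ i, S i i) (q := ∑ i, ∑ j, S i j ^ 2) (t := θ 0) (μ := μ)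
      hm' (Finset.sum_nonneg fun _ _ ↦ sq_nonneg _) (fun α β ↦ ?_) ?_ ?_ ?_
    · have := hpos α β
      rwa [hSη] at this
    · simpa using h00.symm
    · simp only [Finset.sum_add_distrib, Finset.sum_sub_distrib, Finset.sum_neg_distrib, hKS,
        ← Finset.mul_sum, if_true, Finset.sum_const, Finset.card_univ, Fintype.card_fin,
        nsmul_eq_mul, ← pow_two] at htr
      linarith
    · have e (i j : Fin m) : S i j * (-(∑ x, K i x * S x j) - ∑ x, K j x * S x i
          + ((m - 1) * θ 0 - ∑ x, S x x) * S i j + (m - 1) * (θ i.succ * θ j.succ)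
          + if i = j then θ 0 * ∑ x, S x x
            + (1 - m) * (θ 0 ^ 2 + ∑ x : Fin m, θ x.succ ^ 2) else 0) =
          -(S i j * ∑ x, K i x * S x j) - S i j * ∑ x, K j x * S x i
          + ((m - 1) * θ 0 - ∑ x, S x x) * S i j ^ 2
          + (m - 1) * (S i j * θ i.succ * θ j.succ)
          + if i = j then S i j * (θ 0 * ∑ x, S x x
            + (1 - m) * (θ 0 ^ 2 + ∑ x : Fin m, θ x.succ ^ 2)) else 0 := by
        split_ifs <;> ring
      simp only [e, Finset.sum_add_distrib, Finset.sum_sub_distrib, Finset.sum_neg_distrib, hSK,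
        hSK', ← Finset.mul_sum, hSη, Finset.sum_ite_eq, Finset.mem_univ, if_true,
        ← Finset.sum_mul] at hS
      linarith
  have := (Finset.sum_eq_zero_iff_of_nonneg fun _ _ ↦ sq_nonneg _).1 hη i (Finset.mem_univ i)
  exact pow_eq_zero_iff two_ne_zero |>.1 this

end IsAlmostAbelianFrame
end FrameAlgebra

section ConstantFrame

set_option linter.unusedSectionVars false

open VectorField

variable {E : Type*} [NormedAddCommGroup E] [NormedSpace ℝ E] [FiniteDimensional ℝ E]
  {H : Type*} [TopologicalSpace H] {I : ModelWithCorners ℝ E H}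
  {M : Type*} [TopologicalSpace M] [ChartedSpace H M] [IsManifold I ∞ M]
  {ι : Type*} [Fintype ι]

lemma SmoothMetric.contMDiffAt_inner (g : SmoothMetric I M) {n : ℕ∞ω} (hn : n ≤ ∞)
    {X Y : ∀ x : M, TangentSpace I x} {x : M} (hX : CMDiffAt n (T% X) x)
    (hY : CMDiffAt n (T% Y) x) : CMDiffAt n (fun y ↦ g.inner y (X y) (Y y)) x := by
  have : ContMDiffAt I (I.prod 𝓘(ℝ)) n
      (fun m ↦ TotalSpace.mk' ℝ (E := Bundle.Trivial M ℝ) m (g.inner m (X m) (Y m))) x := by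
    apply ContMDiffAt.clm_bundle_apply₂ (F₁ := E) (F₂ := E)
    · exact g.contMDiff.contMDiffAt.of_le hn
    · exact hX
    · exact hY
  simp only [contMDiffAt_totalSpace] at this
  exact this.2

lemma SmoothMetric.mdifferentiableAt_inner (g : SmoothMetric I M)
    {X Y : ∀ x : M, TangentSpace I x} {x : M} (hX : MDiffAt (T% X) x)
    (hY : MDiffAt (T% Y) x) : MDiffAt (fun y ↦ g.inner y (X y) (Y y)) x := by
  have : MDifferentiableAt I (I.prod 𝓘(ℝ))
      (fun m ↦ TotalSpace.mk' ℝ (E := Bundle.Trivial M ℝ) m (g.inner m (X m) (Y m))) x := by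
    apply MDifferentiableAt.clm_bundle_apply₂ (F₁ := E) (F₂ := E)
    · exact g.contMDiff.contMDiffAt.mdifferentiableAt (by simp)
    · exact hX
    · exact hY
  simp only [mdifferentiableAt_totalSpace] at this
  exact this.2

lemma LinearConnection.sum (D : LinearConnection I M) {κ : Type*} (s : Finset κ)
    {σ : κ → ∀ x : M, TangentSpace I x} {x : M} (hσ : ∀ i ∈ s, MDiffAt (T% (σ i)) x) :
    D (fun y ↦ ∑ i ∈ s, σ i y) x = ∑ i ∈ s, D (σ i) x := by
  classical
  induction s using Finset.induction_on with
  | empty =>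
    simp only [Finset.sum_empty]
    exact D.isCovariantDerivativeOnUniv.zero
  | insert a s ha h =>
    simp only [Finset.mem_insert, forall_eq_or_imp] at hσ
    simp only [Finset.sum_insert ha, ← h hσ.2]
    exact D.isCovariantDerivativeOnUniv.add hσ.1 (.sum_section hσ.2)

/-- The frame `e` consists of `C^2` vector fields, is orthonormal, and has constant structure
coefficients `c`. -/
structure IsConstantFrame [DecidableEq ι] (g : SmoothMetric I M)
    (e : ι → ∀ x : M, TangentSpace I x) (c : ι → ι → ι → ℝ) : Prop where
  contMDiff : ∀ i, CMDiff 2 (T% (e i))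
  inner_eq : ∀ x i j, g.inner x (e i x) (e j x) = if i = j then 1 else 0
  card_eq : Fintype.card ι = Module.finrank ℝ E
  bracket : ∀ i j x, mlieBracket I (e i) (e j) x = ∑ k, c i j k • e k x

namespace IsConstantFrame

variable [DecidableEq ι] {g : SmoothMetric I M} {e : ι → ∀ x : M, TangentSpace I x}
  {c : ι → ι → ι → ℝ} (he : IsConstantFrame g e c)

include he

lemma mdifferentiableAt (i : ι) (x : M) : MDiffAt (T% (e i)) x :=
  (he.contMDiff i).contMDiffAt.mdifferentiableAt two_ne_zero

lemma linearIndependent (x : M) : LinearIndependent ℝ (fun i ↦ e i x) := by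
  rw [Fintype.linearIndependent_iff]
  intro a ha i
  have h : g.inner x (∑ j, a j • e j x) (e i x) = a i := by
    simp [he.inner_eq]
  rw [ha] at h
  simpa using h.symm

/-- The basis of the tangent space at `x` given by a frame. -/
def basis (x : M) : Module.Basis ι ℝ (TangentSpace I x) :=
  haveI : FiniteDimensional ℝ (TangentSpace I x) := inferInstanceAs (FiniteDimensional ℝ E)
  Module.Basis.mk (he.linearIndependent x)
    (((he.linearIndependent x).span_eq_top_of_card_eq_finrank' he.card_eq).ge)

@[simp]
lemma basis_apply (x : M) (i : ι) : he.basis x i = e i x := by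
  simp [basis]

lemma basis_repr (x : M) (v : TangentSpace I x) (i : ι) :
    (he.basis x).repr v i = g.inner x v (e i x) := by
  conv_rhs => rw [← (he.basis x).sum_repr v]
  simp [he.inner_eq]

lemma sum_inner_smul (x : M) (v : TangentSpace I x) :
    ∑ i, g.inner x v (e i x) • e i x = v := by
  conv_rhs => rw [← (he.basis x).sum_repr v]
  simp [he.basis_repr]

lemma inner_sum_smul (x : M) (a : ι → ℝ) (i : ι) :
    g.inner x (∑ j, a j • e j x) (e i x) = a i := by
  simp [he.inner_eq]

lemma mdifferentiableAt_sum_smul {a : ι → M → ℝ} {x : M} (ha : ∀ i, MDiffAt (a i) x) :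
    MDiffAt (T% (fun y ↦ ∑ i, a i y • e i y)) x :=
  MDifferentiableAt.sum_section fun i _ ↦ (ha i).smul_section (he.mdifferentiableAt i x)

lemma cov_sum_smul (D : LinearConnection I M) {a : ι → M → ℝ} {x : M}
    (ha : ∀ i, MDiffAt (a i) x) (v : TangentSpace I x) :
    D (fun y ↦ ∑ i, a i y • e i y) x v =
      ∑ i, (a i x • D (e i) x v + mvfderiv I (a i) x v • e i x) := by
  rw [LinearConnection.sum D Finset.univ (σ := fun i y ↦ a i y • e i y)
    fun i _ ↦ (ha i).smul_section (he.mdifferentiableAt i x)]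
  simp only [sum_apply]
  refine Finset.sum_congr rfl fun i _ ↦ ?_
  have := D.isCovariantDerivativeOnUniv.leibniz (he.mdifferentiableAt i x) (ha i)
  exact congr($this v)

/-- Koszul formula for a Weyl connection in a frame in which its Lee form is constant. -/
theorem cov_eq {D : LinearConnection I M} (hD : D.torsion = 0)
    {θ : ∀ x : M, TangentSpace I x →L[ℝ] ℝ} (hθ : IsLeeForm D g θ) {t : ι → ℝ}
    (ht : ∀ i x, θ x (e i x) = t i) (i j : ι) (x : M) :
    D (e j) x (e i x) = ∑ k, weylChristoffel c t i j k • e k x := by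
  set γ : ι → ι → ι → ℝ := fun i j k ↦ g.inner x (D (e j) x (e i x)) (e k x) with hγ
  have hm (i j k) : γ i j k + γ i k j = 2 * t i * if j = k then 1 else 0 := by
    have := hθ.2 (e j) (e k) x (he.mdifferentiableAt j x) (he.mdifferentiableAt k x) (e i x)
    simp only [metricDerivative, he.inner_eq, mvfderiv_const, ht] at this
    rw [g.symm x (e j x)] at this
    simp only [zero_apply] at this
    linarith
  have hT (i j k) : γ i j k - γ j i k = c i j k := by
    have := D.torsion_eq_zero_iff.1 hD (he.mdifferentiableAt i x) (he.mdifferentiableAt j x)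
    rw [he.bracket] at this
    rw [← he.inner_sum_smul x (c i j) k, ← this]
    simp [hγ]
  rw [← he.sum_inner_smul x (D (e j) x (e i x))]
  refine Finset.sum_congr rfl fun k _ ↦ ?_
  congr 1
  change γ i j k = _
  simp only [weylChristoffel, ← hT]
  have h1 := hm i j k
  have h2 := hm j i k
  have h3 := hm k i j
  have e1 (i j : ι) (a : ℝ) : (if i = j then a else 0) = a * if i = j then 1 else 0 := by simp
  rw [e1 j k, e1 i k, e1 i j]
  linarith

lemma contMDiffAt_mvfderiv {f : M → ℝ} {x : M} (hf : CMDiffAt 2 f x) (i : ι) :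
    CMDiffAt 1 (fun y ↦ mvfderiv I f y (e i y)) x := by
  have : IsManifold I ((2 : ℕ∞) + 1) M :=
    IsManifold.of_le (n := ∞) (by exact_mod_cast (le_top : (2 + 1 : ℕ∞) ≤ ⊤))
  have h1 : CMDiffAt 1 (T% (mlieBracket I (e i) (f • e i))) x :=
    ContMDiffAt.mlieBracket_vectorField (m := 1) (n := 2) (he.contMDiff i x)
      (hf.smul_section (he.contMDiff i x)) (by simp [one_add_one_eq_two])
  have h2 : CMDiffAt 1 (fun y ↦ g.inner y (mlieBracket I (e i) (f • e i) y) (e i y)) x :=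
    g.contMDiffAt_inner (by exact_mod_cast le_top) h1
      ((he.contMDiff i x).of_le (by exact_mod_cast one_le_two))
  refine h2.congr_of_eventuallyEq ?_
  have hf' := (contMDiffAt_iff_contMDiffAt_nhds (by simp)).1 hf
  filter_upwards [hf'] with y hy
  rw [mlieBracket_smul_right (hy.mdifferentiableAt two_ne_zero) (he.mdifferentiableAt i y)]
  simp [he.inner_eq, mlieBracket_self]

/-- `X (Y f) - Y (X f) = [X, Y] f` for the fields of a frame. -/
lemma mvfderiv_mvfderiv_sub {f : M → ℝ} {x : M} (hf : CMDiffAt 2 f x) (i j : ι) :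
    mvfderiv I (fun y ↦ mvfderiv I f y (e j y)) x (e i x)
      - mvfderiv I (fun y ↦ mvfderiv I f y (e i y)) x (e j x) =
      ∑ k, c i j k * mvfderiv I f x (e k x) := by
  have hB (a b : ι) (y : M) : MDiffAt (T% (mlieBracket I (e a) (e b))) y := by
    have h : mlieBracket I (e a) (e b) = fun y ↦ ∑ k, c a b k • e k y := by
      ext y
      exact he.bracket a b y
    rw [h]
    exact he.mdifferentiableAt_sum_smul (a := fun k _ ↦ c a b k) fun _ ↦ mdifferentiableAt_const
  have hf1 := hf.mdifferentiableAt two_ne_zero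
  have hf' := (contMDiffAt_iff_contMDiffAt_nhds (by simp)).1 hf
  have hdf (a : ι) : MDiffAt (fun y ↦ mvfderiv I f y (e a y)) x :=
    (he.contMDiffAt_mvfderiv hf a).mdifferentiableAt one_ne_zero
  have key (a b : ι) : mlieBracket I (e a) (mlieBracket I (e b) (f • e i)) x =
      mvfderiv I (fun y ↦ mvfderiv I f y (e b y)) x (e a x) • e i x
        + mvfderiv I f x (e b x) • mlieBracket I (e a) (e i) x
        + (mvfderiv I f x (e a x) • mlieBracket I (e b) (e i) x
        + f x • mlieBracket I (e a) (mlieBracket I (e b) (e i)) x) := by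
    have h : mlieBracket I (e b) (f • e i) =ᶠ[nhds x]
        (fun y ↦ mvfderiv I f y (e b y)) • e i + f • mlieBracket I (e b) (e i) := by
      filter_upwards [hf'] with y hy
      exact mlieBracket_smul_right (hy.mdifferentiableAt two_ne_zero) (he.mdifferentiableAt i y)
    rw [(Filter.EventuallyEq.refl (nhds x) (e a)).mlieBracket_vectorField_eq h,
      mlieBracket_add_right ((hdf b).smul_section (he.mdifferentiableAt i x))
        (hf1.smul_section (hB b i x)),
      mlieBracket_smul_right (hdf b) (he.mdifferentiableAt i x),
      mlieBracket_smul_right hf1 (hB b i x)]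
  have h2 (a : ι) : CMDiffAt (minSmoothness ℝ 2) (T% (e a)) x := by
    simpa using he.contMDiff a x
  have h2f : CMDiffAt (minSmoothness ℝ 2) (T% (f • e i)) x := by
    simpa using! hf.smul_section (he.contMDiff i x)
  have J0 := leibniz_identity_mlieBracket_apply (h2 i) (h2 j) (h2 i)
  have J := leibniz_identity_mlieBracket_apply (h2 i) (h2 j) h2f
  rw [key, key, mlieBracket_smul_right hf1 (he.mdifferentiableAt i x), J0, he.bracket i j x] at J
  have J' := congr(g.inner x $J (e i x))
  simp [he.inner_eq] at J'
  linarith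

end IsConstantFrame
end ConstantFrame

section FrameCurvature

set_option linter.unusedSectionVars false

open VectorField

variable {E : Type*} [NormedAddCommGroup E] [NormedSpace ℝ E] [FiniteDimensional ℝ E]
  {H : Type*} [TopologicalSpace H] {I : ModelWithCorners ℝ E H}
  {M : Type*} [TopologicalSpace M] [ChartedSpace H M] [IsManifold I ∞ M]
  {ι : Type*} [Fintype ι]

lemma sum_coord_eq_trace {κ V : Type*} [Fintype κ] [AddCommGroup V] [Module ℝ V]
    (b : Module.Basis κ ℝ V) (f : V →ₗ[ℝ] V) :
    ∑ i, b.coord i (f (b i)) = LinearMap.trace ℝ V f := by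
  classical
  rw [LinearMap.trace_eq_matrix_trace ℝ b]
  simp [Matrix.trace, LinearMap.toMatrix_apply]

namespace IsConstantFrame

variable [DecidableEq ι] {g : SmoothMetric I M} {e : ι → ∀ x : M, TangentSpace I x}
  {c Γ : ι → ι → ι → ℝ} (he : IsConstantFrame g e c) {D : LinearConnection I M}

include he

lemma mdifferentiableAt_inner {Z : ∀ x : M, TangentSpace I x} {x : M} (hZ : MDiffAt (T% Z) x)
    (k : ι) : MDiffAt (fun y ↦ g.inner y (Z y) (e k y)) x :=
  g.mdifferentiableAt_inner hZ (he.mdifferentiableAt k x)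

omit he in
lemma mdifferentiableAt_finset_sum {κ : Type*} (s : Finset κ) {f : κ → M → ℝ} {x : M}
    (hf : ∀ j ∈ s, MDiffAt (f j) x) : MDiffAt (fun y ↦ ∑ j ∈ s, f j y) x := by
  classical
  induction s using Finset.induction_on with
  | empty => simpa using mdifferentiableAt_const
  | insert a s ha h =>
    simp only [Finset.mem_insert, forall_eq_or_imp] at hf
    simp only [Finset.sum_insert ha]
    exact hf.1.add (h hf.2)

variable (hΓ : ∀ i j x, D (e j) x (e i x) = ∑ k, Γ i j k • e k x)

include hΓ

lemma cov_sum_smul_apply {a : ι → M → ℝ} {x : M} (ha : ∀ i, MDiffAt (a i) x) (i : ι) :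
    D (fun y ↦ ∑ k, a k y • e k y) x (e i x) =
      ∑ k, (mvfderiv I (a k) x (e i x) + ∑ j, Γ i j k * a j x) • e k x := by
  rw [he.cov_sum_smul D ha]
  simp only [hΓ, Finset.sum_add_distrib, add_smul, Finset.smul_sum, Finset.sum_smul, smul_smul]
  rw [add_comm, Finset.sum_comm]
  simp only [mul_comm]

lemma cov_apply {Z : ∀ x : M, TangentSpace I x} {x : M} (hZ : MDiffAt (T% Z) x) (i : ι) :
    D Z x (e i x) = ∑ k, (mvfderiv I (fun y ↦ g.inner y (Z y) (e k y)) x (e i x)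
      + ∑ j, Γ i j k * g.inner x (Z x) (e j x)) • e k x := by
  conv_lhs => rw [show Z = fun y ↦ ∑ k, g.inner y (Z y) (e k y) • e k y from
    funext fun y ↦ (he.sum_inner_smul y (Z y)).symm]
  exact he.cov_sum_smul_apply hΓ (fun k ↦ he.mdifferentiableAt_inner hZ k) i

lemma eventually_cov_apply {Z : ∀ x : M, TangentSpace I x} {x : M} (hZ : CMDiffAt 2 (T% Z) x)
    (i : ι) : ∀ᶠ y in nhds x, D Z y (e i y) =
      ∑ k, (mvfderiv I (fun y ↦ g.inner y (Z y) (e k y)) y (e i y)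
        + ∑ j, Γ i j k * g.inner y (Z y) (e j y)) • e k y := by
  filter_upwards [(contMDiffAt_iff_contMDiffAt_nhds (by simp)).1 hZ] with y hy
  exact he.cov_apply hΓ (hy.mdifferentiableAt two_ne_zero) i

omit hΓ in
lemma mdifferentiableAt_coeff {Z : ∀ x : M, TangentSpace I x} {x : M}
    (hZ : CMDiffAt 2 (T% Z) x) (i k : ι) :
    MDiffAt (fun y ↦ mvfderiv I (fun y ↦ g.inner y (Z y) (e k y)) y (e i y)
        + ∑ j, Γ i j k * g.inner y (Z y) (e j y)) x := by
  have h2 (k : ι) : CMDiffAt 2 (fun y ↦ g.inner y (Z y) (e k y)) x :=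
    g.contMDiffAt_inner ENat.LEInfty.out hZ (he.contMDiff k x)
  refine ((he.contMDiffAt_mvfderiv (h2 k) i).mdifferentiableAt one_ne_zero).add ?_
  have h (j : ι) : MDiffAt (fun y ↦ Γ i j k * g.inner y (Z y) (e j y)) x :=
    mdifferentiableAt_const.mul ((h2 j).mdifferentiableAt two_ne_zero)
  exact mdifferentiableAt_finset_sum _ fun j _ ↦ h j

lemma mdifferentiableAt_cov {Z : ∀ x : M, TangentSpace I x} {x : M} (hZ : CMDiffAt 2 (T% Z) x)
    (i : ι) : MDiffAt (T% (fun y ↦ D Z y (e i y))) x := by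
  refine (he.mdifferentiableAt_sum_smul
    fun k ↦ he.mdifferentiableAt_coeff (Γ := Γ) hZ i k).congr_of_eventuallyEq ?_
  filter_upwards [he.eventually_cov_apply hΓ hZ i] with y hy
  rw [hy]

lemma cov_cov_apply {Z : ∀ x : M, TangentSpace I x} {x : M} (hZ : CMDiffAt 2 (T% Z) x)
    (a b : ι) : D (fun y ↦ D Z y (e b y)) x (e a x) =
      ∑ k, (mvfderiv I (fun y ↦ mvfderiv I (fun y ↦ g.inner y (Z y) (e k y)) y (e b y)) x (e a x)
        + ∑ j, Γ b j k * mvfderiv I (fun y ↦ g.inner y (Z y) (e j y)) x (e a x)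
        + ∑ l, Γ a l k * (mvfderiv I (fun y ↦ g.inner y (Z y) (e l y)) x (e b x)
          + ∑ j, Γ b j l * g.inner x (Z x) (e j x))) • e k x := by
  have h2 (k : ι) : CMDiffAt 2 (fun y ↦ g.inner y (Z y) (e k y)) x :=
    g.contMDiffAt_inner ENat.LEInfty.out hZ (he.contMDiff k x)
  have h (k j : ι) : MDiffAt (fun y ↦ Γ b j k * g.inner y (Z y) (e j y)) x :=
    mdifferentiableAt_const.mul ((h2 j).mdifferentiableAt two_ne_zero)
  rw [D.isCovariantDerivativeOnUniv.congr_of_eventuallyEq (he.mdifferentiableAt_cov hΓ hZ b)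
    (he.mdifferentiableAt_sum_smul fun k ↦ he.mdifferentiableAt_coeff (Γ := Γ) hZ b k)
    Filter.univ_mem (he.eventually_cov_apply hΓ hZ b),
    he.cov_sum_smul_apply hΓ fun k ↦ he.mdifferentiableAt_coeff (Γ := Γ) hZ b k]
  refine Finset.sum_congr rfl fun k _ ↦ ?_
  congr 2
  rw [mvfderiv_fun_add ((he.contMDiffAt_mvfderiv (h2 k) b).mdifferentiableAt one_ne_zero)
    (mdifferentiableAt_finset_sum _ fun j _ ↦ h k j), add_apply]
  congr 1
  have hs (s : Finset ι) : mvfderiv I (fun y ↦ ∑ j ∈ s, Γ b j k * g.inner y (Z y) (e j y)) x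
      (e a x) = ∑ j ∈ s, Γ b j k * mvfderiv I (fun y ↦ g.inner y (Z y) (e j y)) x (e a x) := by
    classical
    induction s using Finset.induction_on with
    | empty => simp [mvfderiv_const]
    | insert j s hj hs =>
      simp only [Finset.sum_insert hj]
      rw [mvfderiv_fun_add (h k j) (mdifferentiableAt_finset_sum _ fun j _ ↦ h k j), add_apply, hs,
        mvfderiv_fun_mul mdifferentiableAt_const ((h2 j).mdifferentiableAt two_ne_zero)]
      simp [mvfderiv_const]
  exact hs _

/-- The curvature in a frame with constant structure coefficients. -/
lemma curvature_apply {Z : ∀ x : M, TangentSpace I x} {x : M} (hZ : CMDiffAt 2 (T% Z) x)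
    (a b : ι) : curvature D (e a) (e b) Z x = ∑ k, (∑ j, g.inner x (Z x) (e j x) *
      ∑ d, (c a b d * Γ d j k - Γ b j d * Γ a d k + Γ a j d * Γ b d k)) • e k x := by
  have h2 (k : ι) : CMDiffAt 2 (fun y ↦ g.inner y (Z y) (e k y)) x :=
    g.contMDiffAt_inner ENat.LEInfty.out hZ (he.contMDiff k x)
  rw [curvature, he.cov_cov_apply hΓ hZ, he.cov_cov_apply hΓ hZ, he.bracket, map_sum]
  simp only [map_smul, he.cov_apply hΓ (hZ.mdifferentiableAt two_ne_zero), Finset.smul_sum,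
    smul_smul]
  rw [Finset.sum_comm]
  simp only [← Finset.sum_smul]
  rw [← Finset.sum_sub_distrib, ← Finset.sum_add_distrib]
  refine Finset.sum_congr rfl fun k _ ↦ ?_
  rw [← sub_smul, ← add_smul]
  congr 1
  have hc := he.mvfderiv_mvfderiv_sub (h2 k) a b
  simp only [mul_add, Finset.sum_add_distrib, Finset.sum_sub_distrib, mul_sub]
  rw [← hc]
  have e1 : ∑ d, c a b d * ∑ j, Γ d j k * g.inner x (Z x) (e j x) =
      ∑ j, g.inner x (Z x) (e j x) * ∑ d, c a b d * Γ d j k := by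
    simp only [Finset.mul_sum]
    rw [Finset.sum_comm]
    exact Finset.sum_congr rfl fun _ _ ↦ Finset.sum_congr rfl fun _ _ ↦ by ring
  have e2 (a b : ι) : ∑ l, Γ a l k * ∑ j, Γ b j l * g.inner x (Z x) (e j x) =
      ∑ j, g.inner x (Z x) (e j x) * ∑ d, Γ b j d * Γ a d k := by
    simp only [Finset.mul_sum]
    rw [Finset.sum_comm]
    exact Finset.sum_congr rfl fun _ _ ↦ Finset.sum_congr rfl fun _ _ ↦ by ring
  rw [e1, e2, e2]
  ring

lemma mdifferentiableAt_cov_field {Y Z : ∀ x : M, TangentSpace I x} {x : M}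
    (hZ : CMDiffAt 2 (T% Z) x) (hY : MDiffAt (T% Y) x) :
    MDiffAt (T% (fun y ↦ D Z y (Y y))) x := by
  have h (y : M) : D Z y (Y y) = ∑ k, g.inner y (Y y) (e k y) • D Z y (e k y) := by
    conv_lhs => rw [← he.sum_inner_smul y (Y y)]
    simp
  simp only [h]
  exact MDifferentiableAt.sum_section fun k _ ↦
    (he.mdifferentiableAt_inner hY k).smul_section (he.mdifferentiableAt_cov hΓ hZ k)

lemma tensorialAt_curvature_left {Y Z : ∀ x : M, TangentSpace I x} {x : M}
    (hZ : CMDiffAt 2 (T% Z) x) :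
    TensorialAt I E (fun X ↦ curvature D X Y Z x) x where
  smul {f X} hf hX := by
    have h : D (fun y ↦ D Z y ((f • X) y)) x =
        f x • D (fun y ↦ D Z y (X y)) x + (mvfderiv I f x).smulRight (D Z x (X x)) := by
      rw [← D.isCovariantDerivativeOnUniv.leibniz (he.mdifferentiableAt_cov_field hΓ hZ hX) hf]
      congr 1
      ext y
      simp
    simp only [curvature, h, mlieBracket_smul_left hf hX]
    simp
    module
  add {X X'} hX hX' := by
    have h : D (fun y ↦ D Z y ((X + X') y)) x =
        D (fun y ↦ D Z y (X y)) x + D (fun y ↦ D Z y (X' y)) x := by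
      rw [← D.isCovariantDerivativeOnUniv.add (he.mdifferentiableAt_cov_field hΓ hZ hX)
        (he.mdifferentiableAt_cov_field hΓ hZ hX')]
      congr 1
      ext y
      simp
    simp only [curvature, h, mlieBracket_add_left hX hX']
    simp
    module

omit he hΓ in
lemma curvature_swap (X Y Z : ∀ x : M, TangentSpace I x) (x : M) :
    curvature D X Y Z x = -curvature D Y X Z x := by
  simp only [curvature, mlieBracket_swap_apply (V := X), map_neg]
  module

lemma tensorialAt_curvature_right {X Z : ∀ x : M, TangentSpace I x} {x : M}
    (hZ : CMDiffAt 2 (T% Z) x) :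
    TensorialAt I E (fun Y ↦ curvature D X Y Z x) x where
  smul hf hY := by
    rw [curvature_swap X, curvature_swap X,
      (he.tensorialAt_curvature_left hΓ hZ).smul hf hY, smul_neg]
  add {Y Y'} hY hY' := by
    rw [curvature_swap X, curvature_swap X Y, curvature_swap X Y',
      (he.tensorialAt_curvature_left hΓ hZ).add hY hY', neg_add]

/-- The Ricci tensor in a frame with constant structure coefficients. -/
theorem ricci_eq (x : M) (u w : TangentSpace I x) : ricci D x u w =
    ∑ a, ∑ b, g.inner x u (e a x) * g.inner x w (e b x) * frameRicci c Γ a b := by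
  have hZ : CMDiffAt 2 (T% (FiberBundle.extend E w)) x := FiberBundle.contMDiffAt_extend ..
  obtain ⟨R, hR, hRe⟩ : ∃ R : TangentSpace I x →L[ℝ] TangentSpace I x →L[ℝ] TangentSpace I x,
      (∀ v, R u v = curvature D (FiberBundle.extend E u) (FiberBundle.extend E v)
        (FiberBundle.extend E w) x) ∧
      ∀ a b, R (e a x) (e b x) = curvature D (e a) (e b) (FiberBundle.extend E w) x :=
    ⟨TensorialAt.mkHom₂ (fun X Y ↦ curvature D X Y (FiberBundle.extend E w) x) x
      (fun _ _ ↦ he.tensorialAt_curvature_left hΓ hZ)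
      (fun _ _ ↦ he.tensorialAt_curvature_right hΓ hZ),
      fun v ↦ TensorialAt.mkHom₂_apply_eq_extend ..,
      fun a b ↦ TensorialAt.mkHom₂_apply _ _ (he.mdifferentiableAt a x) (he.mdifferentiableAt b x)⟩
  have hRz (a z : ι) : g.inner x (R (e a x) (e z x)) (e z x) = ∑ b, g.inner x w (e b x) *
      ∑ d, (c a z d * Γ d b z - Γ z b d * Γ a d z + Γ a b d * Γ z d z) := by
    rw [hRe, he.curvature_apply hΓ hZ, he.inner_sum_smul, FiberBundle.extend_apply_self]
  have hcurv : ricci D x u w = LinearMap.trace ℝ (TangentSpace I x) (R u).toLinearMap := by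
    rw [← sum_coord_eq_trace (tangentBasis (I := I) x)]
    simp only [ContinuousLinearMap.coe_coe, hR, ricci]
  rw [hcurv, ← sum_coord_eq_trace (he.basis x)]
  simp only [Module.Basis.coord_apply, he.basis_repr, he.basis_apply, ContinuousLinearMap.coe_coe]
  have hu : R u = ∑ a, g.inner x u (e a x) • R (e a x) := by
    conv_lhs => rw [← he.sum_inner_smul x u]
    simp only [map_sum, map_smul]
  simp only [hu]
  simp only [sum_apply, smul_apply, map_sum, map_smul, hRz, smul_eq_mul,
    frameRicci, Finset.mul_sum]
  rw [Finset.sum_comm]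
  refine Finset.sum_congr rfl fun a _ ↦ ?_
  rw [Finset.sum_comm]
  refine Finset.sum_congr rfl fun b _ ↦ Finset.sum_congr rfl fun z _ ↦
    Finset.sum_congr rfl fun d _ ↦ ?_
  ring

end IsConstantFrame
end FrameCurvature

section LocalPrimitive

set_option linter.unusedSectionVars false

open VectorField Topology

variable {E : Type*} [NormedAddCommGroup E] [NormedSpace ℝ E] [FiniteDimensional ℝ E]
  {H : Type*} [TopologicalSpace H] {I : ModelWithCorners ℝ E H} [I.Boundaryless]
  {M : Type*} [TopologicalSpace M] [ChartedSpace H M] [IsManifold I ∞ M]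

/-- `f` is a smooth primitive of the 1-form `θ` at `x`. -/
def IsPrimitiveAt (θ : ∀ x : M, TangentSpace I x →L[ℝ] ℝ) (f : M → ℝ) (x : M) : Prop :=
  CMDiffAt ∞ f x ∧ mvfderiv I f x = θ x

/-- The 1-form `θ` in the chart at `x₀`. -/
def chartOneForm (θ : ∀ x : M, TangentSpace I x →L[ℝ] ℝ) (x₀ : M) (z : E) : E →L[ℝ] ℝ :=
  (θ ((extChartAt I x₀).symm z)).comp (mfderiv 𝓘(ℝ, E) I (extChartAt I x₀).symm z)

lemma contMDiffAt_chart_symm {x₀ : M} {z : E} (hz : z ∈ (extChartAt I x₀).target) :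
    CMDiffAt ∞ (extChartAt I x₀).symm z :=
  (contMDiffOn_extChartAt_symm x₀).contMDiffAt ((isOpen_extChartAt_target x₀).mem_nhds hz)

lemma isInvertible_mfderiv_chart_symm {x₀ : M} {z : E} (hz : z ∈ (extChartAt I x₀).target) :
    (mfderiv 𝓘(ℝ, E) I (extChartAt I x₀).symm z).IsInvertible := by
  simpa [I.range_eq_univ] using isInvertible_mfderivWithin_extChartAt_symm (I := I) hz

lemma chartOneForm_apply (θ : ∀ x : M, TangentSpace I x →L[ℝ] ℝ) {x₀ x : M}
    (hx : x ∈ (extChartAt I x₀).source) (u : TangentSpace I x) :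
    chartOneForm θ x₀ (extChartAt I x₀ x) (mfderiv I 𝓘(ℝ, E) (extChartAt I x₀) x u) = θ x u := by
  have h := mfderivWithin_extChartAt_symm_comp_mfderiv_extChartAt' (I := I) hx
  rw [I.range_eq_univ, mfderivWithin_univ] at h
  have hu : mfderiv 𝓘(ℝ, E) I (extChartAt I x₀).symm (extChartAt I x₀ x)
      (mfderiv I 𝓘(ℝ, E) (extChartAt I x₀) x u) = u := congr($h u)
  have hθ (y : M) (hy : y = x) : (θ y : E →L[ℝ] ℝ) u = θ x u := by
    subst hy
    rfl
  rw [← hθ _ ((extChartAt I x₀).left_inv hx)]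
  exact congrArg (θ ((extChartAt I x₀).symm (extChartAt I x₀ x)) : E →L[ℝ] ℝ) hu

lemma contDiffOn_chartOneForm {θ : ∀ x : M, TangentSpace I x →L[ℝ] ℝ} (hθ : IsSmoothOneForm θ)
    (x₀ : M) : ContDiffOn ℝ ∞ (chartOneForm θ x₀) (extChartAt I x₀).target := by
  rw [contDiffOn_clm_apply]
  intro v z hz
  refine ContDiffAt.contDiffWithinAt ?_
  rw [← contMDiffAt_iff_contDiffAt]
  have hopen := isOpen_extChartAt_target (I := I) x₀
  have h1 : CMDiffAt ∞ (fun z : E ↦ (⟨z, v⟩ : TangentBundle 𝓘(ℝ, E) E)) z := by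
    rw [contMDiffAt_vectorSpace_iff_contDiffAt (V := fun _ ↦ v)]
    exact contDiffAt_const
  have h2 := ((contMDiffOn_extChartAt_symm (I := I) (n := ∞) x₀).contMDiffOn_tangentMapWithin
    (m := ∞) le_rfl hopen.uniqueMDiffOn).contMDiffAt (x := ⟨z, v⟩)
    ((hopen.preimage (FiberBundle.continuous_proj E _)).mem_nhds hz)
  have h3 : CMDiffAt ∞ (fun z : E ↦ (⟨(extChartAt I x₀).symm z,
      mfderiv 𝓘(ℝ, E) I (extChartAt I x₀).symm z v⟩ : TangentBundle I M)) z := by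
    refine (h2.comp z h1).congr_of_eventuallyEq ?_
    filter_upwards [hopen.mem_nhds hz] with y hy
    simp only [tangentMapWithin, Function.comp_apply, mfderivWithin_of_isOpen hopen hy]
  have : ContMDiffAt 𝓘(ℝ, E) (I.prod 𝓘(ℝ)) ∞
      (fun z ↦ TotalSpace.mk' ℝ (E := Bundle.Trivial M ℝ) ((extChartAt I x₀).symm z)
        (chartOneForm θ x₀ z v)) z := by
    apply ContMDiffAt.clm_bundle_apply (𝕜 := ℝ) (F₁ := E) (F₂ := ℝ) (E₂ := Bundle.Trivial M ℝ)
      (b := (extChartAt I x₀).symm) (ϕ := fun z ↦ θ ((extChartAt I x₀).symm z))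
      (v := fun z ↦ mfderiv 𝓘(ℝ, E) I (extChartAt I x₀).symm z v)
    · exact ContMDiffAt.comp z hθ.contMDiffAt (contMDiffAt_chart_symm hz)
    · exact h3
  simp only [contMDiffAt_totalSpace] at this
  exact this.2

variable {ι : Type*} [Fintype ι] [DecidableEq ι] {g : SmoothMetric I M}
  {e : ι → ∀ x : M, TangentSpace I x} {c : ι → ι → ι → ℝ}

/-- A 1-form with constant coefficients `t` in a frame with structure coefficients `c` is closed
if `t` vanishes on brackets. -/
lemma IsConstantFrame.fderiv_chartOneForm_symm (he : IsConstantFrame g e c)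
    {θ : ∀ x : M, TangentSpace I x →L[ℝ] ℝ} (hθ : IsSmoothOneForm θ) {t : ι → ℝ}
    (ht : ∀ i x, θ x (e i x) = t i) (hc : ∀ i j, ∑ k, c i j k * t k = 0) {x₀ : M} {z : E}
    (hz : z ∈ (extChartAt I x₀).target) (u v : E) :
    fderiv ℝ (chartOneForm θ x₀) z u v = fderiv ℝ (chartOneForm θ x₀) z v u := by
  have hopen := isOpen_extChartAt_target (I := I) x₀
  set α := chartOneForm θ x₀ with hα
  have hαd : DifferentiableAt ℝ α z :=
    ((contDiffOn_chartOneForm hθ x₀).contDiffAt (hopen.mem_nhds hz)).differentiableAt (by simp)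
  let V (i : ι) : E → E := mpullback 𝓘(ℝ, E) I (extChartAt I x₀).symm (e i)
  have hV (i : ι) (y : E) (hy : y ∈ (extChartAt I x₀).target) :
      mfderiv 𝓘(ℝ, E) I (extChartAt I x₀).symm y (V i y) = e i ((extChartAt I x₀).symm y) :=
    (isInvertible_mfderiv_chart_symm hy).self_apply_inverse _
  have hVd (i : ι) : DifferentiableAt ℝ (V i) z := by
    refine ContDiffAt.differentiableAt (n := 1) ?_ one_ne_zero
    rw [← contMDiffAt_vectorSpace_iff_contDiffAt]
    exact ContMDiffAt.mpullback_vectorField_preimage (n := 2) (m := 1)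
      ((he.contMDiff i).contMDiffAt.of_le (by exact_mod_cast one_le_two))
      ((contMDiffAt_chart_symm hz).of_le ENat.LEInfty.out)
      (isInvertible_mfderiv_chart_symm hz) one_add_one_eq_two.le
  have hαV (i : ι) : ∀ y ∈ (extChartAt I x₀).target, α y (V i y) = t i := by
    intro y hy
    rw [← ht i ((extChartAt I x₀).symm y), ← hV i y hy]
    rfl
  have hder (i : ι) (u : E) : fderiv ℝ α z u (V i z) + α z (fderiv ℝ (V i) z u) = 0 := by
    have h1 : fderiv ℝ (fun y ↦ α y (V i y)) z = 0 := by
      rw [Filter.EventuallyEq.fderiv_eq (f₁ := fun y ↦ α y (V i y)) (f := fun _ ↦ t i)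
        (by filter_upwards [hopen.mem_nhds hz] with y hy using hαV i y hy)]
      simp
    rw [fderiv_clm_apply hαd (hVd i)] at h1
    have := congr($h1 u)
    simp at this
    linarith
  have hbr (i j : ι) : α z (fderiv ℝ (V j) z (V i z) - fderiv ℝ (V i) z (V j z)) = 0 := by
    have h := mpullback_mlieBracket (𝕜 := ℝ) (I := 𝓘(ℝ, E)) (I' := I) (n := 2)
      (f := (extChartAt I x₀).symm) (x₀ := z) (he.mdifferentiableAt i _) (he.mdifferentiableAt j _)
      ((contMDiffAt_chart_symm hz).of_le ENat.LEInfty.out) (by simp)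
    have hl : mlieBracket 𝓘(ℝ, E) (V i) (V j) z = lieBracket ℝ (V i) (V j) z := by
      rw [← mlieBracketWithin_univ, mlieBracketWithin_eq_lieBracketWithin]
      exact congrFun lieBracketWithin_univ z
    have hsum : mpullback 𝓘(ℝ, E) I (extChartAt I x₀).symm (mlieBracket I (e i) (e j)) z =
        ∑ k, c i j k • V k z := by
      rw [mpullback_apply, he.bracket, map_sum]
      simp only [map_smul]
      rfl
    have hV' : lieBracket ℝ (V i) (V j) z = ∑ k, c i j k • V k z :=
      hl.symm.trans (h.symm.trans hsum)
    change α z (lieBracket ℝ (V i) (V j) z) = 0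
    rw [hV', map_sum, ← hc i j]
    exact Finset.sum_congr rfl fun k _ ↦ by rw [map_smul, hαV k z hz, smul_eq_mul]
  have hspan (u : E) : ∃ a : ι → ℝ, u = ∑ i, a i • V i z := by
    let T : E →L[ℝ] TangentSpace I ((extChartAt I x₀).symm z) :=
      mfderiv 𝓘(ℝ, E) I (extChartAt I x₀).symm z
    have hT (i : ι) : T (V i z) = e i ((extChartAt I x₀).symm z) := hV i z hz
    refine ⟨fun i ↦ g.inner _ (T u) (e i ((extChartAt I x₀).symm z)), ?_⟩
    have hinj : Function.Injective T := (isInvertible_mfderiv_chart_symm hz).injective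
    refine hinj ?_
    rw [map_sum]
    simp only [map_smul, hT]
    exact (he.sum_inner_smul _ (T u)).symm
  obtain ⟨a, rfl⟩ := hspan u
  obtain ⟨b, rfl⟩ := hspan v
  have hs (i j : ι) : fderiv ℝ α z (V i z) (V j z) = fderiv ℝ α z (V j z) (V i z) := by
    have h1 := hder j (V i z)
    have h2 := hder i (V j z)
    have h3 := hbr i j
    rw [map_sub] at h3
    linarith
  simp only [map_sum, map_smul, sum_apply, smul_apply, Finset.smul_sum]
  rw [Finset.sum_comm]
  refine Finset.sum_congr rfl fun i _ ↦ Finset.sum_congr rfl fun j _ ↦ ?_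
  rw [hs, smul_comm]

/-- A closed 1-form with constant coefficients in a frame is locally exact. -/
lemma IsConstantFrame.exists_local_primitive (he : IsConstantFrame g e c)
    {θ : ∀ x : M, TangentSpace I x →L[ℝ] ℝ} (hθ : IsSmoothOneForm θ) {t : ι → ℝ}
    (ht : ∀ i x, θ x (e i x) = t i) (hc : ∀ i j, ∑ k, c i j k * t k = 0) (x₀ : M) :
    ∃ U : Set M, IsOpen U ∧ x₀ ∈ U ∧ ∃ f : M → ℝ, ∀ x ∈ U, IsPrimitiveAt θ f x := by
  have hopen := isOpen_extChartAt_target (I := I) x₀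
  obtain ⟨r, hr, hball⟩ := Metric.isOpen_iff.1 hopen _ (mem_extChartAt_target x₀)
  have hsm := (contDiffOn_chartOneForm hθ x₀).mono hball
  obtain ⟨F, hF⟩ := (convex_ball (extChartAt I x₀ x₀) r).exists_forall_hasFDerivAt_of_fderiv_symmetric
    Metric.isOpen_ball (hsm.differentiableOn (by simp))
    fun z hz u v ↦ he.fderiv_chartOneForm_symm hθ ht hc (hball hz) u v
  refine ⟨(extChartAt I x₀).source ∩ extChartAt I x₀ ⁻¹' Metric.ball (extChartAt I x₀ x₀) r,
    (continuousOn_extChartAt x₀).isOpen_inter_preimage (isOpen_extChartAt_source x₀)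
      Metric.isOpen_ball, ⟨mem_extChartAt_source x₀, Metric.mem_ball_self hr⟩,
    F ∘ extChartAt I x₀, fun x hx ↦ ?_⟩
  have hFs : ContDiffOn ℝ ∞ F (Metric.ball (extChartAt I x₀ x₀) r) := by
    rw [contDiffOn_infty_iff_fderiv_of_isOpen Metric.isOpen_ball]
    refine ⟨fun z hz ↦ (hF z hz).differentiableAt.differentiableWithinAt, ?_⟩
    exact hsm.congr fun z hz ↦ (hF z hz).fderiv
  have hφ : CMDiffAt ∞ (extChartAt I x₀) x :=
    contMDiffAt_extChartAt' (by simpa using hx.1)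
  refine ⟨ContMDiffAt.comp x (hFs.contDiffAt (Metric.isOpen_ball.mem_nhds hx.2)).contMDiffAt hφ, ?_⟩
  have h1 : HasMFDerivAt I 𝓘(ℝ, ℝ) (F ∘ extChartAt I x₀) x
      ((chartOneForm θ x₀ (extChartAt I x₀ x)).comp (mfderiv I 𝓘(ℝ, E) (extChartAt I x₀) x)) :=
    HasMFDerivAt.comp x (hF _ hx.2).hasMFDerivAt (hφ.mdifferentiableAt (by simp)).hasMFDerivAt
  ext u
  have h2 := congr($(h1.mfderiv) u)
  exact h2.trans (chartOneForm_apply θ hx.1 u)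

/-- Two primitives of a 1-form differ by a locally constant function. -/
lemma IsPrimitiveAt.eventually_sub_eq {θ : ∀ x : M, TangentSpace I x →L[ℝ] ℝ} {f f' : M → ℝ}
    {U : Set M} (hU : IsOpen U) (hf : ∀ x ∈ U, IsPrimitiveAt θ f x)
    (hf' : ∀ x ∈ U, IsPrimitiveAt θ f' x) {x₀ : M} (hx₀ : x₀ ∈ U) :
    ∀ᶠ x in 𝓝 x₀, f x - f' x = f x₀ - f' x₀ := by
  have hopen := isOpen_extChartAt_target (I := I) x₀
  have hW : IsOpen ((extChartAt I x₀).target ∩ (extChartAt I x₀).symm ⁻¹' U) :=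
    (continuousOn_extChartAt_symm x₀).isOpen_inter_preimage hopen hU
  obtain ⟨r, hr, hball⟩ := Metric.isOpen_iff.1 hW (extChartAt I x₀ x₀)
    ⟨mem_extChartAt_target x₀, by simpa using hx₀⟩
  set φ := (extChartAt I x₀).symm with hφ
  have hd : ∀ z ∈ Metric.ball (extChartAt I x₀ x₀) r,
      HasFDerivAt (fun z ↦ f (φ z) - f' (φ z)) (0 : E →L[ℝ] ℝ) z := by
    intro z hz
    obtain ⟨hz1, hz2⟩ := hball hz
    have hφz := ((contMDiffAt_chart_symm hz1).mdifferentiableAt (by simp)).hasMFDerivAt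
    have h (f : M → ℝ) (hf : ∀ x ∈ U, IsPrimitiveAt θ f x) :
        HasFDerivAt (f ∘ φ) (chartOneForm θ x₀ z) z := by
      have h2 : HasMFDerivAt I 𝓘(ℝ, ℝ) f (φ z) (mvfderiv I f (φ z)) :=
        ((hf _ hz2).1.mdifferentiableAt (by simp)).hasMFDerivAt
      rw [(hf _ hz2).2] at h2
      exact (HasMFDerivAt.comp z h2 hφz).hasFDerivAt
    have h3 := (h f hf).sub (h f' hf')
    rw [sub_self] at h3
    exact h3
  have hc : ∀ z ∈ Metric.ball (extChartAt I x₀ x₀) r,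
      f (φ z) - f' (φ z) = f (φ (extChartAt I x₀ x₀)) - f' (φ (extChartAt I x₀ x₀)) := by
    intro z hz
    exact (convex_ball _ r).is_const_of_fderivWithin_eq_zero (𝕜 := ℝ)
      (fun z hz ↦ (hd z hz).differentiableAt.differentiableWithinAt)
      (fun z hz ↦ by rw [fderivWithin_of_isOpen Metric.isOpen_ball hz, (hd z hz).fderiv]) hz
      (Metric.mem_ball_self hr)
  have h1 : ∀ᶠ x in 𝓝 x₀, extChartAt I x₀ x ∈ Metric.ball (extChartAt I x₀ x₀) r :=
    (continuousAt_extChartAt x₀) (Metric.ball_mem_nhds _ hr)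
  filter_upwards [h1, extChartAt_source_mem_nhds (I := I) x₀] with x hx hxs
  have := hc _ hx
  rwa [hφ, (extChartAt I x₀).left_inv hxs, (extChartAt I x₀).left_inv (mem_extChartAt_source x₀)]
    at this

end LocalPrimitive

section GlobalPrimitive

set_option linter.unusedSectionVars false

open Topology

/-- The real numbers with the discrete topology. -/
@[ext]
structure DiscreteReal : Type where
  val : ℝ

instance : TopologicalSpace DiscreteReal := ⊥

instance : DiscreteTopology DiscreteReal := ⟨rfl⟩

/-- The affine line bundle with locally constant transition functions `f i - f j`. -/
def primitiveBundle {X : Type*} [TopologicalSpace X] (U : X → Set X) (f : X → X → ℝ)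
    (hU : ∀ i, IsOpen (U i)) (hmem : ∀ i, i ∈ U i)
    (hf : ∀ i j, ∀ x ∈ U i ∩ U j, ∀ᶠ y in 𝓝 x, f i y - f j y = f i x - f j x) :
    FiberBundleCore X X DiscreteReal where
  baseSet := U
  isOpen_baseSet := hU
  indexAt := id
  mem_baseSet_at := hmem
  coordChange i j x v := ⟨v.val + (f i x - f j x)⟩
  coordChange_self i x _ v := by simp
  continuousOn_coordChange i j := by
    rintro ⟨x, v⟩ ⟨hx, -⟩
    apply ContinuousAt.continuousWithinAt
    have h : ∀ᶠ p : X × DiscreteReal in 𝓝 (x, v),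
        DiscreteReal.mk (p.2.val + (f i p.1 - f j p.1)) = ⟨v.val + (f i x - f j x)⟩ := by
      have h1 : ∀ᶠ w : DiscreteReal in 𝓝 v, w = v := by
        rw [nhds_discrete]; exact Filter.eventually_pure.2 rfl
      rw [nhds_prod_eq]
      filter_upwards [(hf i j x hx).prod_mk h1] with p hp
      rw [hp.1, hp.2]
    exact continuousAt_const.congr (h.mono fun p hp ↦ hp.symm)
  coordChange_comp i j k x _ v := by
    ext
    simp only
    ring

/-- On a simply connected space, functions which are given locally up to locally constant functions
can be glued. -/
lemma exists_forall_eventually_sub_eq {X : Type*} [TopologicalSpace X] [SimplyConnectedSpace X]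
    [LocallyPathConnectedSpace X] (U : X → Set X) (f : X → X → ℝ)
    (hU : ∀ i, IsOpen (U i)) (hmem : ∀ i, i ∈ U i)
    (hf : ∀ i j, ∀ x ∈ U i ∩ U j, ∀ᶠ y in 𝓝 x, f i y - f j y = f i x - f j x) :
    ∃ F : X → ℝ, ∀ x, ∀ᶠ y in 𝓝 x, F y - f x y = F x - f x x := by
  let Z := primitiveBundle U f hU hmem hf
  have hcov : IsCoveringMap (Z.proj) :=
    (FiberBundle.isCoveringMap (F := DiscreteReal) (E := Z.Fiber))
  obtain ⟨x₀⟩ : Nonempty X := inferInstance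
  obtain ⟨s, ⟨-, hs⟩, -⟩ := hcov.existsUnique_continuousMap_lifts (ContinuousMap.id X) x₀
    (⟨x₀, DiscreteReal.mk 0⟩ : Z.TotalSpace) rfl
  have hs' (x : X) : (s x).1 = x := congrFun hs x
  let val (p : Z.TotalSpace) : ℝ := DiscreteReal.val p.2
  refine ⟨fun x ↦ val (s x) + f x x, fun x ↦ ?_⟩
  have h1 : ContinuousAt (fun y ↦ (Z.localTriv x (s y)).2) x := by
    have h2 : ContinuousAt (Z.localTriv x) (s x) :=
      (Z.localTriv x).continuousAt (by
        rw [FiberBundleCore.mem_localTriv_source, hs' x]; exact hmem x)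
    exact continuousAt_snd.comp (ContinuousAt.comp (f := s) h2 s.continuous.continuousAt)
  have h3 : ∀ᶠ y in 𝓝 x, (Z.localTriv x (s y)).2 = (Z.localTriv x (s x)).2 := by
    have := h1.tendsto
    rw [nhds_discrete DiscreteReal] at this
    exact Filter.tendsto_pure.1 this
  filter_upwards [h3] with y hy
  have h4 (y : X) : (Z.localTriv x (s y)).2 =
      DiscreteReal.mk (val (s y) + (f (s y).1 (s y).1 - f x (s y).1)) := rfl
  rw [h4, h4, hs' x, hs' y, DiscreteReal.mk.injEq] at hy
  linarith

variable {E : Type*} [NormedAddCommGroup E] [NormedSpace ℝ E] [FiniteDimensional ℝ E]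
  {H : Type*} [TopologicalSpace H] {I : ModelWithCorners ℝ E H} [I.Boundaryless]
  {M : Type*} [TopologicalSpace M] [ChartedSpace H M] [IsManifold I ∞ M]

lemma IsPrimitiveAt.congr_add_const {θ : ∀ x : M, TangentSpace I x →L[ℝ] ℝ} {f F : M → ℝ} {x : M}
    (hf : IsPrimitiveAt θ f x) {a : ℝ} (h : ∀ᶠ y in 𝓝 x, F y - f y = a) :
    IsPrimitiveAt θ F x := by
  have h' : F =ᶠ[𝓝 x] fun y ↦ f y + a := h.mono fun y hy ↦ by
    simp only at hy ⊢; linarith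
  refine ⟨(hf.1.add contMDiffAt_const).congr_of_eventuallyEq h', ?_⟩
  have hd : HasMFDerivAt I 𝓘(ℝ, ℝ) f x (mvfderiv I f x) :=
    (hf.1.mdifferentiableAt (by simp)).hasMFDerivAt
  have h1 := (hd.add (hasMFDerivAt_const a x)).congr_of_eventuallyEq h'
  rw [← hf.2]
  exact h1.mfderiv.trans (add_zero (mvfderiv I f x))

/-- On a simply connected manifold, a 1-form with local primitives has a primitive. -/
lemma exists_primitive [SimplyConnectedSpace M] [LocallyPathConnectedSpace M]
    {θ : ∀ x : M, TangentSpace I x →L[ℝ] ℝ}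
    (h : ∀ x₀, ∃ U, IsOpen U ∧ x₀ ∈ U ∧ ∃ f : M → ℝ, ∀ x ∈ U, IsPrimitiveAt θ f x) :
    ∃ F : M → ℝ, ∀ x, IsPrimitiveAt θ F x := by
  choose U hU hmem f hf using h
  obtain ⟨F, hF⟩ := exists_forall_eventually_sub_eq U f hU hmem fun i j x hx ↦
    IsPrimitiveAt.eventually_sub_eq ((hU i).inter (hU j)) (fun y hy ↦ hf i y hy.1)
      (fun y hy ↦ hf j y hy.2) hx
  exact ⟨F, fun x ↦ (hf x x (hmem x)).congr_add_const (hF x)⟩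

end GlobalPrimitive

/-- Every subspace of codimension one of a Euclidean space contains all but the first vector
of some orthonormal family. -/
lemma exists_orthonormal_of_codim_one {V : Type*} [AddCommGroup V] [Module ℝ V]
    [FiniteDimensional ℝ V] (B : V →ₗ[ℝ] V →ₗ[ℝ] ℝ) (hsymm : ∀ u v, B u v = B v u)
    (hpos : ∀ v, v ≠ 0 → 0 < B v v) (W : Submodule ℝ V) {m : ℕ}
    (hV : Module.finrank ℝ V = m + 1) (hW : Module.finrank ℝ (V ⧸ W) = 1) :
    ∃ b : Fin (m + 1) → V, (∀ i j, B (b i) (b j) = if i = j then 1 else 0) ∧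
      ∀ i : Fin m, b i.succ ∈ W := by
  let core : InnerProductSpace.Core ℝ V :=
    { inner := fun u v ↦ B u v
      conj_inner_symm := fun u v ↦ hsymm v u
      re_inner_nonneg := fun v ↦ by
        rcases eq_or_ne v 0 with rfl | hv
        · simp
        · simpa using (hpos v hv).le
      add_left := fun u v w ↦ by simp
      smul_left := fun r u v ↦ by simp
      definite := fun v hv ↦ by
        by_contra h
        exact (hpos v h).ne' hv }
  let _ : NormedAddCommGroup V := core.toNormedAddCommGroup
  let _ : InnerProductSpace ℝ V := InnerProductSpace.ofCore core.toCore
  have hin (u v : V) : inner ℝ u v = B u v := rfl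
  have hWm : Module.finrank ℝ W = m := by
    have := W.finrank_quotient_add_finrank
    omega
  have hWo : Module.finrank ℝ Wᗮ = 1 := by
    have := W.finrank_add_finrank_orthogonal
    omega
  let w := (stdOrthonormalBasis ℝ W).reindex (finCongr hWm)
  let u := (stdOrthonormalBasis ℝ Wᗮ).reindex (finCongr hWo)
  refine ⟨Fin.cons (u 0 : V) fun i ↦ (w i : V), fun i j ↦ ?_, fun i ↦ by simp⟩
  have hw := orthonormal_iff_ite.1 w.orthonormal
  have hu := orthonormal_iff_ite.1 u.orthonormal 0 0
  rw [← hin]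
  refine Fin.cases ?_ (fun i ↦ ?_) i <;> refine Fin.cases ?_ (fun j ↦ ?_) j
  · simpa only [Fin.cons_zero, if_true, Submodule.coe_inner] using hu
  · simpa [(Fin.succ_ne_zero j).symm] using Submodule.inner_left_of_mem_orthogonal (w j).2 (u 0).2
  · simpa [Fin.succ_ne_zero] using Submodule.inner_right_of_mem_orthogonal (w i).2 (u 0).2
  · simpa using hw i j

section LieAlgebra

variable {L : Type*} [LieRing L] [LieAlgebra ℝ L]

/-- In a Lie algebra, an ideal of codimension one contains all brackets. -/
lemma lie_mem_of_finrank_quotient_eq_one (𝔥 : LieIdeal ℝ L)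
    (h : Module.finrank ℝ (L ⧸ 𝔥.toSubmodule) = 1) (x y : L) : ⁅x, y⁆ ∈ 𝔥 := by
  obtain ⟨v, hv, hspan⟩ := finrank_eq_one_iff'.1 h
  obtain ⟨z, rfl⟩ := Submodule.Quotient.mk_surjective _ v
  have hdec (x : L) : ∃ r : ℝ, ∃ k ∈ 𝔥, x = r • z + k := by
    obtain ⟨r, hr⟩ := hspan (Submodule.Quotient.mk x)
    refine ⟨r, x - r • z, ?_, by abel⟩
    rw [← Submodule.Quotient.mk_smul, eq_comm, Submodule.Quotient.eq] at hr
    exact hr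
  obtain ⟨r, k, hk, rfl⟩ := hdec x
  obtain ⟨s, l, hl, rfl⟩ := hdec y
  have h1 : ⁅r • z, s • z⁆ = 0 := by simp
  rw [add_lie, lie_add, lie_add, h1, zero_add]
  exact add_mem (lie_mem_right ℝ L 𝔥 _ _ hl)
    (add_mem (lie_mem_left ℝ L 𝔥 _ _ hk) (lie_mem_right ℝ L 𝔥 _ _ hl))

/-- The structure coefficients of an almost abelian Lie algebra with a Euclidean inner product, in
an orthonormal basis adapted to the abelian ideal. -/
lemma exists_isAlmostAbelianFrame [FiniteDimensional ℝ L] (hL : IsAlmostAbelian ℝ L)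
    (B : L →ₗ[ℝ] L →ₗ[ℝ] ℝ) (hsymm : ∀ u v, B u v = B v u)
    (hpos : ∀ v, v ≠ 0 → 0 < B v v) {m : ℕ} (hm : Module.finrank ℝ L = m + 1) :
    ∃ (b : Fin (m + 1) → L) (c : Fin (m + 1) → Fin (m + 1) → Fin (m + 1) → ℝ)
      (S K : Fin m → Fin m → ℝ),
      (∀ i j, B (b i) (b j) = if i = j then 1 else 0) ∧
      (∀ i j, ⁅b i, b j⁆ = ∑ k, c i j k • b k) ∧ IsAlmostAbelianFrame c S K := by
  obtain ⟨𝔥, hab, hcodim⟩ := hL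
  obtain ⟨b, hb, hb𝔥⟩ := exists_orthonormal_of_codim_one B hsymm hpos 𝔥.toSubmodule hm hcodim
  have hli : LinearIndependent ℝ b := by
    rw [Fintype.linearIndependent_iff]
    intro r hr i
    have h1 := congr(B $hr (b i))
    simpa [hb] using h1
  let β : Module.Basis (Fin (m + 1)) ℝ L :=
    basisOfLinearIndependentOfCardEqFinrank hli (by simp [hm])
  have hβ (i) : β i = b i := by simp [β]
  have hsum (v : L) : ∑ k, B v (b k) • b k = v := by
    refine Eq.trans (Finset.sum_congr rfl fun k _ ↦ ?_) (β.sum_repr v)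
    rw [hβ]
    congr 1
    conv_lhs => rw [← β.sum_repr v]
    simp [hβ, hb]
  have h0 (x) (hx : x ∈ 𝔥) : B x (b 0) = 0 := by
    have hle : Submodule.span ℝ (Set.range (b ∘ Fin.succ)) = 𝔥.toSubmodule := by
      apply Submodule.eq_of_le_of_finrank_eq
      · rw [Submodule.span_le]
        rintro _ ⟨i, rfl⟩
        exact hb𝔥 i
      · rw [finrank_span_eq_card (hli.comp _ (Fin.succ_injective m)), Fintype.card_fin]
        have := 𝔥.toSubmodule.finrank_quotient_add_finrank
        omega
    have hker : Submodule.span ℝ (Set.range (b ∘ Fin.succ)) ≤ LinearMap.ker (B.flip (b 0)) := by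
      rw [Submodule.span_le]
      rintro _ ⟨i, rfl⟩
      simp [hb]
    exact (hle ▸ hker) hx
  have hlie := lie_mem_of_finrank_quotient_eq_one 𝔥 hcodim
  refine ⟨b, fun i j k ↦ B ⁅b i, b j⁆ (b k),
    fun i j ↦ (B ⁅b 0, b i.succ⁆ (b j.succ) + B ⁅b 0, b j.succ⁆ (b i.succ)) / 2,
    fun i j ↦ (B ⁅b 0, b i.succ⁆ (b j.succ) - B ⁅b 0, b j.succ⁆ (b i.succ)) / 2,
    hb, fun i j ↦ (hsum _).symm, ?_⟩
  refine ⟨fun i j k ↦ ?_, fun i j ↦ h0 _ (hlie _ _), fun i j k ↦ ?_, fun i j ↦ ?_, fun i j ↦ ?_,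
    fun i j ↦ ?_⟩
  · rw [← lie_skew (b i) (b j), map_neg, LinearMap.neg_apply]
  · have h1 : ⁅(⟨b i.succ, hb𝔥 i⟩ : 𝔥), (⟨b j.succ, hb𝔥 j⟩ : 𝔥)⁆ = 0 := trivial_lie_zero _ _ _ _
    have h2 : ⁅b i.succ, b j.succ⁆ = 0 := congr(($h1 : L))
    simp [h2]
  all_goals ring

end LieAlgebra

section ConformalScaling

set_option linter.unusedSectionVars false

variable {E : Type*} [NormedAddCommGroup E] [NormedSpace ℝ E] [FiniteDimensional ℝ E]
  {H : Type*} [TopologicalSpace H] {I : ModelWithCorners ℝ E H}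
  {M : Type*} [TopologicalSpace M] [ChartedSpace H M] [IsManifold I ∞ M]

/-- The metric `e^{2f} g`. -/
def SmoothMetric.rescale (g : SmoothMetric I M) (f : M → ℝ) (hf : CMDiff ∞ f) :
    SmoothMetric I M where
  inner x := Real.exp (2 * f x) • g.inner x
  symm x v w := by
    change Real.exp (2 * f x) * g.inner x v w = Real.exp (2 * f x) * g.inner x w v
    rw [g.symm]
  pos x v hv := mul_pos (Real.exp_pos _) (g.pos x v hv)
  isVonNBounded x := by
    refine ((g.isVonNBounded x).image
      (Real.exp (-f x) • ContinuousLinearMap.id ℝ (TangentSpace I x))).subset fun v hv ↦ ?_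
    refine ⟨Real.exp (f x) • v, ?_, ?_⟩
    · have hv' : Real.exp (2 * f x) * g.inner x v v < 1 := hv
      change g.inner x (Real.exp (f x) • v) (Real.exp (f x) • v) < 1
      simpa [← mul_assoc, ← Real.exp_add, ← two_mul] using hv'
    · change Real.exp (-f x) • Real.exp (f x) • v = v
      rw [smul_smul, ← Real.exp_add, neg_add_cancel, Real.exp_zero, one_smul]
  contMDiff := by
    have h : CMDiff ∞ (fun x ↦ Real.exp (2 * f x)) :=
      (Real.contDiff_exp.comp (contDiff_const.mul contDiff_id)).contMDiff.comp hf
    exact h.smul_section g.contMDiff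

lemma SmoothMetric.rescale_inner (g : SmoothMetric I M) (f : M → ℝ) (hf : CMDiff ∞ f) (x : M)
    (u v : TangentSpace I x) :
    (g.rescale f hf).inner x u v = Real.exp (2 * f x) * g.inner x u v := rfl

lemma metricDerivative_rescale (D : LinearConnection I M) (g : SmoothMetric I M)
    {θ : ∀ x : M, TangentSpace I x →L[ℝ] ℝ} (hθ : IsLeeForm D g θ) (f : M → ℝ) (hf : CMDiff ∞ f)
    (hfθ : ∀ x, mvfderiv I f x = θ x) {Y Z : ∀ x : M, TangentSpace I x} {x : M}
    (hY : MDiffAt (T% Y) x) (hZ : MDiffAt (T% Z) x) (u : TangentSpace I x) :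
    metricDerivative D (g.rescale f hf) Y Z x u = 0 := by
  have h1 := hθ.2 Y Z x hY hZ u
  have hd : HasMFDerivAt I 𝓘(ℝ, ℝ) f x (mvfderiv I f x) :=
    (hf.contMDiffAt.mdifferentiableAt (by simp)).hasMFDerivAt
  have he : HasDerivAt (fun t ↦ Real.exp (2 * t)) (Real.exp (2 * f x) * 2) (f x) := by
    simpa using ((hasDerivAt_id (f x)).const_mul 2).exp
  have h2 : HasMFDerivAt I 𝓘(ℝ, ℝ) (fun y ↦ Real.exp (2 * f y)) x
    ((ContinuousLinearMap.toSpanSingleton ℝ (Real.exp (2 * f x) * 2)).comp (mvfderiv I f x)) :=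
    HasMFDerivAt.comp x (g := fun t ↦ Real.exp (2 * t)) he.hasFDerivAt.hasMFDerivAt hd
  have h3 : mvfderiv I (fun y ↦ Real.exp (2 * f y)) x u = 2 * Real.exp (2 * f x) * θ x u := by
    refine (congr($(h2.mfderiv) u)).trans ?_
    change mvfderiv I f x u * (Real.exp (2 * f x) * 2) = _
    rw [hfθ]
    ring
  unfold metricDerivative at h1 ⊢
  simp only [g.rescale_inner]
  rw [mvfderiv_fun_mul h2.mdifferentiableAt (g.mdifferentiableAt_inner hY hZ)]
  simp only [add_apply, smul_apply, smul_eq_mul, h3]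
  linear_combination Real.exp (2 * f x) * h1

lemma matrix_inv_smul {κ : Type*} [Fintype κ] [DecidableEq κ] {r : ℝ} (hr : r ≠ 0)
    (A : Matrix κ κ ℝ) : (r • A)⁻¹ = r⁻¹ • A⁻¹ := by
  by_cases hA : IsUnit A.det
  · exact Matrix.inv_smul' A (Units.mk0 r hr) hA
  · rw [Matrix.nonsing_inv_apply_not_isUnit _ hA, smul_zero, Matrix.nonsing_inv_apply_not_isUnit]
    rw [Matrix.det_smul]
    rwa [isUnit_iff_ne_zero, mul_ne_zero_iff_left (pow_ne_zero _ hr), ← isUnit_iff_ne_zero]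

lemma scalarCurvature_mul_inner_of_scale (D : LinearConnection I M) (g g' : SmoothMetric I M)
    {x : M} {r : ℝ} (hr : 0 < r) (h : ∀ u v, g'.inner x u v = r * g.inner x u v)
    (u v : TangentSpace I x) :
    scalarCurvature D g' x * g'.inner x u v = scalarCurvature D g x * g.inner x u v := by
  have h2 : (Matrix.of fun k l ↦
      g'.inner x (tangentBasis (I := I) x k) (tangentBasis (I := I) x l)) = r •
      (Matrix.of fun k l ↦
        g.inner x (tangentBasis (I := I) x k) (tangentBasis (I := I) x l)) := by
    ext k l
    simp [h]
  have h1 := matrix_inv_smul hr.ne' (Matrix.of fun k l ↦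
      g.inner x (tangentBasis (I := I) x k) (tangentBasis (I := I) x l))
  rw [← h2] at h1
  have h3 : scalarCurvature D g' x = r⁻¹ * scalarCurvature D g x := by
    simp only [scalarCurvature, h1, Matrix.smul_apply, smul_eq_mul, Finset.mul_sum, mul_assoc]
  rw [h3, h]
  field_simp

end ConformalScaling

section Group

set_option linter.unusedSectionVars false

open VectorField

variable {E : Type*} [NormedAddCommGroup E] [NormedSpace ℝ E] [FiniteDimensional ℝ E]
  {H : Type*} [TopologicalSpace H] {I : ModelWithCorners ℝ E H}
  {G : Type*} [TopologicalSpace G] [ChartedSpace H G] [Group G] [LieGroup I ∞ G]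

lemma mulInvariantVectorField_sum_smul {κ : Type*} (s : Finset κ) (r : κ → ℝ)
    (v : κ → GroupLieAlgebra I G) (x : G) :
    mulInvariantVectorField (∑ k ∈ s, r k • v k) x =
      ∑ k ∈ s, r k • mulInvariantVectorField (v k) x := by
  have h := map_sum (mfderiv I I (fun y ↦ x * y) (1 : G)) (fun k ↦ r k • v k) s
  simp only [map_smul] at h
  exact h

lemma IsLeftInvariantMetric.inner_mulInvariantVectorField {g : SmoothMetric I G}
    (hg : IsLeftInvariantMetric g) (u v : GroupLieAlgebra I G) (x : G) :
    g.inner x (mulInvariantVectorField u x) (mulInvariantVectorField v x) = g.inner 1 u v := by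
  have h (y : G) (hy : y = x) (a b : E) :
      g.inner y (a : TangentSpace I y) (b : TangentSpace I y) =
        g.inner x (a : TangentSpace I x) (b : TangentSpace I x) := by
    subst hy; rfl
  exact (h (x * 1) (mul_one x) _ _).symm.trans (hg x 1 u v)

lemma IsLeftInvariantOneForm.apply_mulInvariantVectorField {θ : ∀ x : G, TangentSpace I x →L[ℝ] ℝ}
    (hθ : IsLeftInvariantOneForm θ) (u : GroupLieAlgebra I G) (x : G) :
    θ x (mulInvariantVectorField u x) = θ 1 u := by
  have h (y : G) (hy : y = x) (a : E) :
      θ y (a : TangentSpace I y) = θ x (a : TangentSpace I x) := by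
    subst hy; rfl
  exact (h (x * 1) (mul_one x) _).symm.trans (hθ x 1 u)

/-- A left-invariant metric on an almost abelian Lie group has a left-invariant orthonormal frame
adapted to the abelian ideal. -/
lemma exists_leftInvariant_frame (hG : IsAlmostAbelian ℝ (GroupLieAlgebra I G))
    {g : SmoothMetric I G} (hg : IsLeftInvariantMetric g) {m : ℕ}
    (hm : Module.finrank ℝ E = m + 1) :
    ∃ (b : Fin (m + 1) → GroupLieAlgebra I G) (c : Fin (m + 1) → Fin (m + 1) → Fin (m + 1) → ℝ)
      (S K : Fin m → Fin m → ℝ),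
      IsConstantFrame g (fun i ↦ mulInvariantVectorField (b i)) c ∧ IsAlmostAbelianFrame c S K := by
  have : FiniteDimensional ℝ (GroupLieAlgebra I G) := inferInstanceAs (FiniteDimensional ℝ E)
  obtain ⟨b, c, S, K, hb, hc, hcS⟩ := exists_isAlmostAbelianFrame hG
    (LinearMap.mk₂ ℝ (fun u v : GroupLieAlgebra I G ↦ g.inner 1 u v)
      (by simp) (by simp) (by simp) (by simp)) (fun u v ↦ g.symm 1 u v)
    (fun v hv ↦ g.pos 1 v hv) hm
  refine ⟨b, c, S, K, ⟨fun i ↦ ?_, fun x i j ↦ ?_, by simp [hm], fun i j x ↦ ?_⟩, hcS⟩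
  · exact (contMDiff_mulInvariantVectorField (b i)).of_le le_minSmoothness
  · rw [hg.inner_mulInvariantVectorField]
    exact hb i j
  · rw [← mulInvariantVector_mlieBracket, ← GroupLieAlgebra.bracket_def, hc,
      mulInvariantVectorField_sum_smul]

/-- The Ricci tensor of a left-invariant Weyl-Einstein structure on an almost abelian Lie group is
symmetric, and its Lee form vanishes on the derived algebra. -/
lemma WeylStructure.exists_frame {c : ConformalClass I G}
    (hG : IsAlmostAbelian ℝ (GroupLieAlgebra I G)) {m : ℕ} (hm : 2 ≤ m)
    (hdim : Module.finrank ℝ E = m + 1) (D : WeylStructure c) (hE : D.IsWeylEinstein)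
    {g : SmoothMetric I G} (hgc : g ∈ c) (hg : IsLeftInvariantMetric g)
    {θ : ∀ x : G, TangentSpace I x →L[ℝ] ℝ} (hθ : IsLeeForm D.conn g θ)
    (hθi : IsLeftInvariantOneForm θ) :
    (∀ x u v, ricci D.conn x u v = ricci D.conn x v u) ∧
    ∃ (e : Fin (m + 1) → ∀ x : G, TangentSpace I x)
      (s : Fin (m + 1) → Fin (m + 1) → Fin (m + 1) → ℝ) (t : Fin (m + 1) → ℝ),
      IsConstantFrame g e s ∧ (∀ i x, θ x (e i x) = t i) ∧ ∀ i j, ∑ k, s i j k * t k = 0 := by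
  obtain ⟨b, s, S, K, he, hs⟩ := exists_leftInvariant_frame hG hg hdim
  set e : Fin (m + 1) → ∀ x : G, TangentSpace I x := fun i ↦ mulInvariantVectorField (b i) with he'
  have ht (i x) : θ x (e i x) = θ 1 (b i) := hθi.apply_mulInvariantVectorField (b i) x
  have hΓ := he.cov_eq D.torsion_eq_zero hθ ht
  have hric := he.ricci_eq hΓ
  have hricf (x i j) : ricci D.conn x (e i x) (e j x) =
      frameRicci s (weylChristoffel s fun i ↦ θ 1 (b i)) i j := by
    rw [hric]
    simp [he.inner_eq]
  obtain ⟨g', hg'c, hg'⟩ := hE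
  obtain ⟨f, -, hf⟩ : Conformal g g' := Quotient.exact (hgc.trans hg'c.symm)
  have hzero := hs.lee_eq_zero hm (fun i ↦ θ 1 (b i))
    (1 / (Module.finrank ℝ E : ℝ) * scalarCurvature D.conn g' 1 * Real.exp (2 * f 1)) (by
      intro i j
      rw [← hricf 1, ← hricf 1, hg', hf, he.inner_eq]
      split_ifs <;> ring)
  refine ⟨fun x u v ↦ ?_, e, s, _, he, ht, fun i j ↦ ?_⟩
  · rw [hric, hric, Finset.sum_comm]
    refine Finset.sum_congr rfl fun i _ ↦ Finset.sum_congr rfl fun j _ ↦ ?_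
    rw [hs.ricci_symm _ hzero i j]
    ring
  · rw [Fin.sum_univ_succ, hs.ideal]
    simp [hzero]

lemma WeylStructure.exists_einstein_metric [I.Boundaryless] [SimplyConnectedSpace G]
    [LocallyPathConnectedSpace G] (hdim : 3 ≤ Module.finrank ℝ E)
    (hG : IsAlmostAbelian ℝ (GroupLieAlgebra I G)) {c : ConformalClass I G}
    (hc : IsConformalLieGroup c) (D : WeylStructure c) (hD : D.IsLeftInvariant)
    (hE : D.IsWeylEinstein) : ∃ h ∈ c, IsEinstein h ∧ IsLeviCivita D.conn h := by
  obtain ⟨g, hgc, hg⟩ := hc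
  obtain ⟨m, hm⟩ := Nat.exists_eq_add_of_le' (show 1 ≤ Module.finrank ℝ E by omega)
  obtain ⟨θ, hθ⟩ := D.preserves g hgc
  obtain ⟨hsymm, e, s, t, he, ht, hst⟩ :=
    D.exists_frame hG (by omega : 2 ≤ m) hm hE hgc hg hθ (hD g hgc hg θ hθ)
  obtain ⟨F, hF⟩ := exists_primitive (he.exists_local_primitive hθ.1 ht hst)
  have hFs : CMDiff ∞ F := fun x ↦ (hF x).1
  have hconf : Conformal g (g.rescale F hFs) := ⟨F, hFs, g.rescale_inner F hFs⟩
  have hhc : g.rescale F hFs ∈ c := (Quotient.sound hconf).symm.trans hgc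
  have hLC : IsLeviCivita D.conn (g.rescale F hFs) :=
    ⟨D.torsion_eq_zero, fun Y Z x hY hZ u ↦
      metricDerivative_rescale D.conn g hθ F hFs (fun x ↦ (hF x).2) hY hZ u⟩
  obtain ⟨g', hg'c, hg'⟩ := hE
  obtain ⟨f, -, hf⟩ : Conformal (g.rescale F hFs) g' := Quotient.exact (hhc.trans hg'c.symm)
  refine ⟨_, hhc, ⟨D.conn, hLC, D.smooth, fun x u v ↦ ?_⟩, hLC⟩
  have h1 := hg' x u v
  rw [hsymm x v u, add_self_div_two, mul_assoc,
    scalarCurvature_mul_inner_of_scale D.conn _ g' (Real.exp_pos _) (hf x)] at h1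
  rw [h1, mul_assoc]

end Group
end WeylGeometry

end

theorem mainTheorem7 (n : ℕ) (hn : 3 ≤ n) (G : Type*) [TopologicalSpace G]
    [ChartedSpace (EuclideanSpace ℝ (Fin n)) G] [Group G] [LieGroup (𝓡 n) ∞ G]
    [SimplyConnectedSpace G]
    (hG : IsAlmostAbelian ℝ (GroupLieAlgebra (𝓡 n) G))
    (c : WeylGeometry.ConformalClass (𝓡 n) G) (hc : WeylGeometry.IsConformalLieGroup c)
    (D : WeylGeometry.WeylStructure c) (hD : D.IsLeftInvariant) (hE : D.IsWeylEinstein) :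
    ∃ h ∈ c, WeylGeometry.IsEinstein h ∧ WeylGeometry.IsLeviCivita D.conn h := by
  have : LocallyPathConnectedSpace G :=
    ChartedSpace.locallyPathConnectedSpace (EuclideanSpace ℝ (Fin n)) G
  exact D.exists_einstein_metric (by simpa using hn) hG hc hD hE
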